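/- Let $T>0$ and consider $\dot x=A(t)x+B(t)u+B_w(t)w$, $z=C(t)x+D(t)u$, where $A,B,B_w,C,D$ are real, piecewise-continuous, $T$-periodic matrix functions, $(A,B)$ is stabilizable (by a piecewise-continuous $T$-periodic feedback), $(C,A)$ is observable, $D^\top C=0$ and $D^\top D=I$, and the disturbance satisfies $\|w(t)\|\le 1$. Fix a piecewise-continuous $T$-periodic function $\alpha$ that is positive and bounded away from $0$. For a piecewise-continuous $T$-periodic gain $K$ (control $u=Kx$), the associated periodic inescapable ellipsoids $\mathcal E_{\alpha,K}(t)=\{x: x^\top P(t)^{-1}x\le 1\}$ are given by a $T$-periodic solution $P$ of $$\dot P=(A+BK)P+P(A+BK)^\top+\alpha P+\tfrac1\alpha B_wB_w^\top ,$$ where degenerate ellipsoids ($P(t)\succeq 0$ singular) are allowed; their size is $\operatorname{size}(\mathcal E_{\alpha,K})=\frac1T\int_0^T\operatorname{trace}\big((C+DK)P(C+DK)^\top\big)\,dt$. Call $K$ admissible if $A+BK+\frac{\alpha}{2}I$ is exponentially stable. (Differential equations are understood for continuous functions, off a locally finite set of times.) (1) If an admissible gain exists, then the Riccati differential equation $$-\dot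 Q=QA+A^\top Q+\alpha Q+C^\top C-QBB^\top Q$$ has exactly one positive-definite $T$-periodic solution $Q$. (2) If $Q$ is a positive-definite $T$-periodic solution of this equation, then $K^*=-B^\top Q$ is admissible, the $T$-periodic positive-semidefinite solution $P^*$ of the above equation for $P$ with $K=K^*$ exists and is unique, and $K^*$ minimizes the size: for every piecewise-continuous $T$-periodic gain $K$ and every $T$-periodic positive-semidefinite solution $P$ of the equation for this $K$, the size given by $(K,P)$ is at least the size given by $(K^*,P^*)$. If the two are equal and $P(t)\succ0$ for all $t$, then $K(t)=K^*(t)$ for almost every $t$. -/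

import Mathlib

open Filter Topology Matrix MeasureTheory

namespace PeriodicLTV

/-- A subset of the real line with finitely many points in every bounded interval. -/
def LocallyFiniteSet (S : Set ℝ) : Prop :=
  ∀ a b : ℝ, (S ∩ Set.Icc a b).Finite

/-- Piecewise continuity on the real line: in every bounded interval there are only finitely many
points of discontinuity, and finite one-sided limits exist at every point. -/
def PiecewiseContinuous {E : Type*} [TopologicalSpace E] (f : ℝ → E) : Prop :=
  (∃ S : Set ℝ, LocallyFiniteSet S ∧ ∀ t, t ∉ S → ContinuousAt f t) ∧
    ∀ t, (∃ l, Tendsto f (𝓝[<] t) (𝓝 l)) ∧ (∃ r, Tendsto f (𝓝[>] t) (𝓝 r))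

/-- `x` is a solution on the whole real line of the linear equation `x' = A(t) x`: a continuous
function that satisfies the equation off a locally finite set of times (the coefficients are only
piecewise continuous). -/
def IsTrajectory {n : ℕ} (A : ℝ → Matrix (Fin n) (Fin n) ℝ) (x : ℝ → Fin n → ℝ) : Prop :=
  Continuous x ∧
    ∃ S : Set ℝ, LocallyFiniteSet S ∧ ∀ t, t ∉ S → HasDerivAt x (A t *ᵥ x t) t

/-- `X` is a solution on the whole real line of the matrix differential equation
`X' = F(t, X)`: a continuous function that satisfies the equation, entry by entry, off a locally
finite set of times. -/
def IsMatrixSolution {n : ℕ} (F : ℝ → Matrix (Fin n) (Fin n) ℝ → Matrix (Fin n) (Fin n) ℝ)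
    (X : ℝ → Matrix (Fin n) (Fin n) ℝ) : Prop :=
  Continuous X ∧
    ∃ S : Set ℝ, LocallyFiniteSet S ∧
      ∀ t, t ∉ S → ∀ i j, HasDerivAt (fun s => X s i j) (F t (X t) i j) t

/-- Exponential stability of `x' = A(t) x`. -/
def ExponentiallyStable {n : ℕ} (A : ℝ → Matrix (Fin n) (Fin n) ℝ) : Prop :=
  ∃ M lam : ℝ, 0 < lam ∧ ∀ x : ℝ → Fin n → ℝ, IsTrajectory A x →
    ∀ s t : ℝ, s ≤ t → ‖x t‖ ≤ M * Real.exp (-lam * (t - s)) * ‖x s‖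

/-- Observability of `(C, A)`: a trajectory of `x' = A(t) x` whose output `C(t) x(t)` vanishes
for almost all `t ≥ t₀` vanishes at `t₀`.  ("Almost all" because the values of `C` at its points
of discontinuity carry no information.) -/
def Observable {n k : ℕ} (C : ℝ → Matrix (Fin k) (Fin n) ℝ)
    (A : ℝ → Matrix (Fin n) (Fin n) ℝ) : Prop :=
  ∀ (t₀ : ℝ) (x : ℝ → Fin n → ℝ), IsTrajectory A x →
    (∀ᵐ t : ℝ, t₀ ≤ t → C t *ᵥ x t = 0) → x t₀ = 0

/-- Admissible gains: piecewise continuous and `T`-periodic. -/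
def IsGain {n m : ℕ} (T : ℝ) (K : ℝ → Matrix (Fin m) (Fin n) ℝ) : Prop :=
  PiecewiseContinuous K ∧ Function.Periodic K T

/-- Stabilizability of a `T`-periodic pair `(A, B)` by a `T`-periodic state feedback. -/
def Stabilizable {n m : ℕ} (T : ℝ) (A : ℝ → Matrix (Fin n) (Fin n) ℝ)
    (B : ℝ → Matrix (Fin n) (Fin m) ℝ) : Prop :=
  ∃ K, IsGain T K ∧ ExponentiallyStable fun t => A t + B t * K t

/-- The system `x' = A x + B u + B_w w`, `z = C x + D u` with piecewise continuous
`T`-periodic coefficients, `(A, B)` stabilizable, `(C, A)` observable, and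
`Dᵀ [C D] = [0 I]`. -/
structure IsPlant {n m k q : ℕ} (T : ℝ) (A : ℝ → Matrix (Fin n) (Fin n) ℝ)
    (B : ℝ → Matrix (Fin n) (Fin m) ℝ) (Bw : ℝ → Matrix (Fin n) (Fin q) ℝ)
    (C : ℝ → Matrix (Fin k) (Fin n) ℝ) (D : ℝ → Matrix (Fin k) (Fin m) ℝ) : Prop where
  period_pos : 0 < T
  pc_A : PiecewiseContinuous A
  pc_B : PiecewiseContinuous B
  pc_Bw : PiecewiseContinuous Bw
  pc_C : PiecewiseContinuous C
  pc_D : PiecewiseContinuous D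
  periodic_A : Function.Periodic A T
  periodic_B : Function.Periodic B T
  periodic_Bw : Function.Periodic Bw T
  periodic_C : Function.Periodic C T
  periodic_D : Function.Periodic D T
  stabilizable : Stabilizable T A B
  observable : Observable C A
  orth : ∀ t, (D t)ᵀ * C t = 0
  unit : ∀ t, (D t)ᵀ * D t = 1

/-- Admissible parameters `α`: `T`-periodic, piecewise continuous, positive and bounded away
from zero, so that `1 / α` is piecewise continuous as well. -/
structure IsParameter (T : ℝ) (α : ℝ → ℝ) : Prop where
  pc : PiecewiseContinuous α
  periodic : Function.Periodic α T
  pos : ∃ c : ℝ, 0 < c ∧ ∀ t, c ≤ α t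

/-- The condition under which the closed-loop ellipsoid for `α` and the gain `K` is well defined:
`K` is piecewise continuous and `T`-periodic, and `A + B K + (α / 2) I` is exponentially
stable. -/
def IsAdmissibleGain {n m : ℕ} (T : ℝ) (A : ℝ → Matrix (Fin n) (Fin n) ℝ)
    (B : ℝ → Matrix (Fin n) (Fin m) ℝ) (α : ℝ → ℝ) (K : ℝ → Matrix (Fin m) (Fin n) ℝ) : Prop :=
  IsGain T K ∧
    ExponentiallyStable fun t => A t + B t * K t + (α t / 2) • (1 : Matrix (Fin n) (Fin n) ℝ)

/-- `P` is the matrix of a periodic ellipsoid `{x | xᵀ P(t)⁻¹ x ≤ 1}` associated with `α` and the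
closed loop under `u = K x`: a `T`-periodic solution of
`P' = (A + B K) P + P (A + B K)ᵀ + α P + (1 / α) B_w B_wᵀ`.
Degenerate ellipsoids (`P` only positive semidefinite) are included. -/
def IsEllipsoidMatrix {n m q : ℕ} (T : ℝ) (A : ℝ → Matrix (Fin n) (Fin n) ℝ)
    (B : ℝ → Matrix (Fin n) (Fin m) ℝ) (Bw : ℝ → Matrix (Fin n) (Fin q) ℝ) (α : ℝ → ℝ)
    (K : ℝ → Matrix (Fin m) (Fin n) ℝ) (P : ℝ → Matrix (Fin n) (Fin n) ℝ) : Prop :=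
  Function.Periodic P T ∧ (∀ t, (P t).PosSemidef) ∧
    IsMatrixSolution (fun t X => (A t + B t * K t) * X + X * (A t + B t * K t)ᵀ + α t • X
      + (1 / α t) • (Bw t * (Bw t)ᵀ)) P

/-- The size `(1 / T) ∫₀ᵀ trace (C_K P C_Kᵀ) dt`, `C_K = C + D K`, of the ellipsoid with
matrix `P`. -/
noncomputable def size {n m k : ℕ} (T : ℝ) (C : ℝ → Matrix (Fin k) (Fin n) ℝ)
    (D : ℝ → Matrix (Fin k) (Fin m) ℝ) (K : ℝ → Matrix (Fin m) (Fin n) ℝ)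
    (P : ℝ → Matrix (Fin n) (Fin n) ℝ) : ℝ :=
  (1 / T) * ∫ t in (0 : ℝ)..T,
    ((C t + D t * K t) * P t * (C t + D t * K t)ᵀ).trace

/-- `Q` is a positive definite `T`-periodic solution of
`-Q' = Q A + Aᵀ Q + α Q + Cᵀ C - Q B Bᵀ Q`. -/
def IsRiccatiSolution {n m k : ℕ} (T : ℝ) (A : ℝ → Matrix (Fin n) (Fin n) ℝ)
    (B : ℝ → Matrix (Fin n) (Fin m) ℝ) (C : ℝ → Matrix (Fin k) (Fin n) ℝ) (α : ℝ → ℝ)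
    (Q : ℝ → Matrix (Fin n) (Fin n) ℝ) : Prop :=
  Function.Periodic Q T ∧ (∀ t, (Q t).PosDef) ∧
    IsMatrixSolution (fun t X => -(X * A t + (A t)ᵀ * X + α t • X + (C t)ᵀ * C t
      - X * B t * (B t)ᵀ * X)) Q

end PeriodicLTV

/-! Replacing `A` by `A + (α/2) I` absorbs the terms `α P` and `α Q`. The problem becomes periodic
linear-quadratic control, with a forward Lyapunov equation for `P`, driven by the noise `W = (1/α)
B_w B_wᵀ`, and the standard Riccati equation for `Q`. Observability survives the shift, because the
shift only rescales trajectories by a positive scalar.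

Optimality is a duality argument. Completing the square shows that, for every gain `K`, a Riccati
solution `Q` also solves the backward Lyapunov equation of the loop under `K` with right-hand side
`CᵀC + KᵀK - ΔᵀΔ`, where `Δ = K + BᵀQ`. Differentiating `trace (Q P)` cancels the system matrix, and
the integral over a period vanishes. This gives `size = (1/T) (∫ trace (Δ P Δᵀ) + ∫ trace (Q W))`,
see `IsRiccati.size_eq`. The second integral does not involve `K`, and the first is nonnegative and
vanishes for `Δ = 0`. If it vanishes while `P` is positive definite, then `Δ = 0` almost everywhere.
Stability of the competing loop plays no role here, only the periodicity and semidefiniteness of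
`P`.

Admissibility of `-BᵀQ` is Lyapunov's theorem (`IsLyapunov.exponentiallyStable`): `xᵀQx` never
increases along the loop, and if it stayed constant then output and control would vanish,
contradicting observability unless `x = 0`. Compactness turns this into a uniform contraction.
Uniqueness of `Q` follows because each of two positive definite solutions stabilizes, so the
comparison principle for Lyapunov equations orders them both ways.

Existence of `Q` is Kleinman's policy iteration: from a stabilizing gain, compute its cost matrix,
pass to the gain that this cost suggests, and repeat. The costs decrease and are bounded below, and
their limit solves the Riccati equation by dominated convergence in the integrated equations. The
matrix `P` is obtained from the backward theory by reversing time and passing to the adjoint system.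
-/

namespace PeriodicLTV

/-! ### Locally finite exceptional sets and monotonicity across them -/

section LocallyFinite

theorem LocallyFiniteSet.empty : LocallyFiniteSet ∅ := fun a b => by simp

theorem LocallyFiniteSet.union {S S' : Set ℝ} (h : LocallyFiniteSet S)
    (h' : LocallyFiniteSet S') : LocallyFiniteSet (S ∪ S') := fun a b => by
  rw [Set.union_inter_distrib_right]
  exact (h a b).union (h' a b)

theorem LocallyFiniteSet.countable {S : Set ℝ} (h : LocallyFiniteSet S) : S.Countable := by
  have hS : S = ⋃ k : ℕ, S ∩ Set.Icc (-(k : ℝ)) k := by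
    ext x
    simp only [Set.mem_iUnion, Set.mem_inter_iff, Set.mem_Icc]
    constructor
    · intro hx
      obtain ⟨k, hk⟩ := exists_nat_ge |x|
      exact ⟨k, hx, (abs_le.mp hk).1, (abs_le.mp hk).2⟩
    · rintro ⟨k, hx, -⟩
      exact hx
  rw [hS]
  exact Set.countable_iUnion fun k => (h _ _).countable

theorem LocallyFiniteSet.ae_notMem {S : Set ℝ} (h : LocallyFiniteSet S) :
    ∀ᵐ t : ℝ, t ∉ S :=
  h.countable.ae_notMem _

theorem LocallyFiniteSet.neg {S : Set ℝ} (h : LocallyFiniteSet S) :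
    LocallyFiniteSet {t | -t ∈ S} := fun a b => by
  refine ((h (-b) (-a)).image fun t => -t).subset ?_
  rintro t ⟨ht, h1, h2⟩
  exact ⟨-t, ⟨ht, by linarith, by linarith⟩, by simp⟩

theorem LocallyFiniteSet.translate {S : Set ℝ} (h : LocallyFiniteSet S) (c : ℝ) :
    LocallyFiniteSet {t | t + c ∈ S} := fun a b => by
  refine ((h (a + c) (b + c)).image fun t => t - c).subset ?_
  rintro t ⟨ht, h1, h2⟩
  exact ⟨t + c, ⟨ht, by linarith, by linarith⟩, by simp⟩

/-- A continuous function whose derivative is nonpositive off a locally finite set decreases. -/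
theorem LocallyFiniteSet.le_of_deriv_nonpos {S : Set ℝ} (hS : LocallyFiniteSet S) {g : ℝ → ℝ}
    (hg : Continuous g) {a b : ℝ} (hab : a ≤ b)
    (hd : ∀ t ∈ Set.Ioo a b, t ∉ S → ∃ g' ≤ 0, HasDerivAt g g' t) : g b ≤ g a := by
  -- Induction on the number of exceptional points inside the open interval: split at one of them,
  -- so that both halves contain fewer. Continuity alone glues the pieces.
  suffices H : ∀ N : ℕ, ∀ a b : ℝ, a ≤ b →
      (∀ t ∈ Set.Ioo a b, t ∉ S → ∃ g' ≤ 0, HasDerivAt g g' t) →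
      (S ∩ Set.Ioo a b).ncard ≤ N → g b ≤ g a from H _ a b hab hd le_rfl
  clear hab hd a b
  have hfin : ∀ a b, (S ∩ Set.Ioo a b).Finite := fun a b =>
    (hS a b).subset (Set.inter_subset_inter_right _ Set.Ioo_subset_Icc_self)
  have hnil : ∀ a b : ℝ, a ≤ b → (∀ t ∈ Set.Ioo a b, t ∉ S → ∃ g' ≤ 0, HasDerivAt g g' t) →
      S ∩ Set.Ioo a b = ∅ → g b ≤ g a := by
    intro a b hab hd hne
    have hd' : ∀ t ∈ Set.Ioo a b, ∃ g' ≤ 0, HasDerivAt g g' t := fun t ht =>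
      hd t ht fun hts => (Set.eq_empty_iff_forall_notMem.mp hne t) ⟨hts, ht⟩
    have := antitoneOn_of_deriv_nonpos (convex_Icc a b) hg.continuousOn
      (fun t ht => by
        rw [interior_Icc] at ht
        obtain ⟨g', -, h⟩ := hd' t ht
        exact h.differentiableAt.differentiableWithinAt)
      (fun t ht => by
        rw [interior_Icc] at ht
        obtain ⟨g', h0, h⟩ := hd' t ht
        rw [h.deriv]; exact h0)
    exact this (Set.left_mem_Icc.mpr hab) (Set.right_mem_Icc.mpr hab) hab
  intro N
  induction N with
  | zero =>
    intro a b hab hd hc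
    exact hnil a b hab hd ((Set.ncard_eq_zero (hfin a b)).mp (Nat.le_zero.mp hc))
  | succ N ih =>
    intro a b hab hd hc
    rcases Set.eq_empty_or_nonempty (S ∩ Set.Ioo a b) with hne | ⟨c, hcS, hca, hcb⟩
    · exact hnil a b hab hd hne
    · have hlt : ∀ u v, Set.Ioo u v ⊆ Set.Ioo a b → c ∉ Set.Ioo u v →
          (S ∩ Set.Ioo u v).ncard ≤ N := by
        intro u v huv hcn
        have : (S ∩ Set.Ioo u v).ncard < (S ∩ Set.Ioo a b).ncard := by
          apply Set.ncard_lt_ncard _ (hfin a b)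
          refine ⟨Set.inter_subset_inter_right _ huv, fun hsub => hcn (hsub ⟨hcS, hca, hcb⟩).2⟩
        omega
      have s1 : Set.Ioo a c ⊆ Set.Ioo a b := Set.Ioo_subset_Ioo_right hcb.le
      have s2 : Set.Ioo c b ⊆ Set.Ioo a b := Set.Ioo_subset_Ioo_left hca.le
      exact (ih c b hcb.le (fun t ht => hd t (s2 ht)) (hlt _ _ s2 (by simp))).trans
        (ih a c hca.le (fun t ht => hd t (s1 ht)) (hlt _ _ s1 (by simp)))

theorem LocallyFiniteSet.eq_of_deriv_zero {S : Set ℝ} (hS : LocallyFiniteSet S) {g : ℝ → ℝ}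
    (hg : Continuous g) (hd : ∀ t, t ∉ S → HasDerivAt g 0 t) (a b : ℝ) : g a = g b := by
  have key : ∀ a b, a ≤ b → g a = g b := fun a b hab => by
    apply le_antisymm
    · have := hS.le_of_deriv_nonpos hg.neg hab
        (fun t _ ht => ⟨0, le_rfl, by simpa using (hd t ht).neg⟩)
      simpa using this
    · exact hS.le_of_deriv_nonpos hg hab (fun t _ ht => ⟨0, le_rfl, hd t ht⟩)
  rcases le_total a b with h | h
  · exact key a b h
  · exact (key b a h).symm

end LocallyFinite

/-! ### Calculus of piecewise continuous functions -/

section Piecewise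

variable {E F G : Type*} [TopologicalSpace E] [TopologicalSpace F] [TopologicalSpace G]

theorem PiecewiseContinuous.comp {f : ℝ → E} (hf : PiecewiseContinuous f) {g : E → F}
    (hg : Continuous g) : PiecewiseContinuous fun t => g (f t) := by
  obtain ⟨⟨S, hS, hc⟩, hl⟩ := hf
  refine ⟨⟨S, hS, fun t ht => hg.continuousAt.comp (hc t ht)⟩, fun t => ?_⟩
  obtain ⟨⟨l, hl⟩, ⟨r, hr⟩⟩ := hl t
  exact ⟨⟨g l, (hg.tendsto l).comp hl⟩, ⟨g r, (hg.tendsto r).comp hr⟩⟩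

theorem PiecewiseContinuous.prodMk {f : ℝ → E} {g : ℝ → F} (hf : PiecewiseContinuous f)
    (hg : PiecewiseContinuous g) : PiecewiseContinuous fun t => (f t, g t) := by
  obtain ⟨⟨S, hS, hc⟩, hl⟩ := hf
  obtain ⟨⟨S', hS', hc'⟩, hl'⟩ := hg
  refine ⟨⟨S ∪ S', hS.union hS', fun t ht => ?_⟩, fun t => ?_⟩
  · rw [Set.mem_union, not_or] at ht
    exact (hc t ht.1).prodMk (hc' t ht.2)
  · obtain ⟨⟨l, hl⟩, ⟨r, hr⟩⟩ := hl t
    obtain ⟨⟨l', hl'⟩, ⟨r', hr'⟩⟩ := hl' t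
    exact ⟨⟨_, hl.prodMk_nhds hl'⟩, ⟨_, hr.prodMk_nhds hr'⟩⟩

theorem PiecewiseContinuous.comp₂ {f : ℝ → E} {g : ℝ → F} (hf : PiecewiseContinuous f)
    (hg : PiecewiseContinuous g) {h : E → F → G} (hh : Continuous fun p : E × F => h p.1 p.2) :
    PiecewiseContinuous fun t => h (f t) (g t) :=
  (hf.prodMk hg).comp hh

theorem _root_.Continuous.piecewiseContinuous {f : ℝ → E} (hf : Continuous f) :
    PiecewiseContinuous f :=
  ⟨⟨∅, .empty, fun _ _ => hf.continuousAt⟩,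
    fun _ => ⟨⟨_, hf.continuousAt.tendsto.mono_left nhdsWithin_le_nhds⟩,
      ⟨_, hf.continuousAt.tendsto.mono_left nhdsWithin_le_nhds⟩⟩⟩

theorem PiecewiseContinuous.add [Add E] [ContinuousAdd E] {f g : ℝ → E}
    (hf : PiecewiseContinuous f) (hg : PiecewiseContinuous g) :
    PiecewiseContinuous fun t => f t + g t :=
  hf.comp₂ hg continuous_add

theorem PiecewiseContinuous.neg [Neg E] [ContinuousNeg E] {f : ℝ → E}
    (hf : PiecewiseContinuous f) : PiecewiseContinuous fun t => -f t :=
  hf.comp continuous_neg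

theorem PiecewiseContinuous.sub [AddGroup E] [ContinuousSub E] {f g : ℝ → E}
    (hf : PiecewiseContinuous f) (hg : PiecewiseContinuous g) :
    PiecewiseContinuous fun t => f t - g t :=
  hf.comp₂ hg continuous_sub

theorem PiecewiseContinuous.comp_neg {f : ℝ → E} (hf : PiecewiseContinuous f) :
    PiecewiseContinuous fun t => f (-t) := by
  obtain ⟨⟨S, hS, hc⟩, hl⟩ := hf
  refine ⟨⟨_, hS.neg, fun t ht => ?_⟩, fun t => ?_⟩
  · exact ContinuousAt.comp (g := f) (hc (-t) ht) continuous_neg.continuousAt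
  · obtain ⟨⟨l, hl⟩, ⟨r, hr⟩⟩ := hl (-t)
    refine ⟨⟨r, hr.comp ?_⟩, ⟨l, hl.comp ?_⟩⟩
    · exact tendsto_neg_nhdsLT
    · exact tendsto_neg_nhdsGT

/-- One-sided limits bound the function near each point, and compactness makes the bound uniform. -/
theorem PiecewiseContinuous.exists_bound {f : ℝ → ℝ} (hf : PiecewiseContinuous f) (a b : ℝ) :
    ∃ c, ∀ t ∈ Set.Icc a b, |f t| ≤ c := by
  refine isCompact_Icc.induction_on (p := fun s => ∃ c, ∀ t ∈ s, |f t| ≤ c)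
    ⟨0, by simp⟩ ?_ ?_ ?_
  · rintro s s' hss ⟨c, hc⟩
    exact ⟨c, fun t ht => hc t (hss ht)⟩
  · rintro s s' ⟨c, hc⟩ ⟨c', hc'⟩
    refine ⟨max c c', ?_⟩
    rintro t (ht | ht)
    · exact (hc t ht).trans (le_max_left _ _)
    · exact (hc' t ht).trans (le_max_right _ _)
  · intro x _
    obtain ⟨⟨l, hl⟩, ⟨r, hr⟩⟩ := hf.2 x
    have h1 : ∀ᶠ t in 𝓝[<] x, |f t| < |l| + 1 :=
      hl.abs.eventually_lt_const (by linarith)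
    have h2 : ∀ᶠ t in 𝓝[>] x, |f t| < |r| + 1 :=
      hr.abs.eventually_lt_const (by linarith)
    -- The term `|f x|` is needed because the one-sided limits do not control the value at `x`
    -- itself.
    refine ⟨{t | |f t| ≤ max (|l| + 1) (max (|r| + 1) |f x|)}, mem_nhdsWithin_of_mem_nhds ?_,
      ⟨_, fun t ht => ht⟩⟩
    rw [eventually_nhdsWithin_iff] at h1 h2
    filter_upwards [h1, h2] with t ht1 ht2
    rcases lt_trichotomy t x with h | h | h
    · exact (ht1 h).le.trans (le_max_left _ _)
    · rw [h]; simp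
    · exact (ht2 h).le.trans ((le_max_left _ _).trans (le_max_right _ _))

theorem PiecewiseContinuous.exists_bound_of_periodic {f : ℝ → ℝ} (hf : PiecewiseContinuous f)
    {T : ℝ} (hT : 0 < T) (hp : Function.Periodic f T) : ∃ c, ∀ t, |f t| ≤ c := by
  obtain ⟨c, hc⟩ := hf.exists_bound 0 T
  refine ⟨c, fun t => ?_⟩
  obtain ⟨s, hs, hst⟩ := hp.exists_mem_Ico₀ hT t
  rw [hst]
  exact hc s ⟨hs.1, hs.2.le⟩

theorem PiecewiseContinuous.aestronglyMeasurable {E : Type*} [TopologicalSpace E]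
    [TopologicalSpace.PseudoMetrizableSpace E] [SecondCountableTopology E] {f : ℝ → E}
    (hf : PiecewiseContinuous f) : AEStronglyMeasurable f volume := by
  obtain ⟨⟨S, hS, hc⟩, -⟩ := hf
  have h1 : ContinuousOn f Sᶜ := fun t ht => (hc t ht).continuousWithinAt
  borelize E
  have h2 := h1.aestronglyMeasurable (μ := volume) hS.countable.measurableSet.compl
  have : volume.restrict Sᶜ = (volume : Measure ℝ) := by
    rw [Measure.restrict_eq_self_of_ae_mem]
    exact hS.ae_notMem
  rwa [this] at h2

theorem PiecewiseContinuous.intervalIntegrable {f : ℝ → ℝ} (hf : PiecewiseContinuous f)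
    (a b : ℝ) : IntervalIntegrable f volume a b := by
  obtain ⟨c, hc⟩ := hf.exists_bound (min a b) (max a b)
  rw [intervalIntegrable_iff]
  refine Measure.integrableOn_of_bounded (M := c) (by simp) hf.aestronglyMeasurable ?_
  rw [ae_restrict_iff' measurableSet_uIoc]
  exact Eventually.of_forall fun t ht => hc t (Set.Ioc_subset_Icc_self ht)

theorem PiecewiseContinuous.hasDerivAt_integral {f : ℝ → ℝ} (hf : PiecewiseContinuous f)
    (a : ℝ) {t : ℝ} (ht : ContinuousAt f t) :
    HasDerivAt (fun u => ∫ s in a..u, f s) (f t) t :=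
  intervalIntegral.integral_hasDerivAt_right (hf.intervalIntegrable a t)
    ⟨Set.univ, univ_mem, by simpa using hf.aestronglyMeasurable⟩ ht

theorem PiecewiseContinuous.continuous_integral {f : ℝ → ℝ} (hf : PiecewiseContinuous f)
    (a : ℝ) : Continuous fun u => ∫ s in a..u, f s :=
  intervalIntegral.continuous_primitive (fun _ _ => hf.intervalIntegrable _ _) a

end Piecewise

/-! ### Piecewise continuous matrix functions and entry bounds -/

section MatrixPiecewise

variable {a b c : ℕ}

theorem PiecewiseContinuous.entry {X : ℝ → Matrix (Fin a) (Fin b) ℝ}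
    (hX : PiecewiseContinuous X) (i : Fin a) (j : Fin b) : PiecewiseContinuous fun t => X t i j :=
  hX.comp (g := fun M : Matrix (Fin a) (Fin b) ℝ => M i j) (by fun_prop)

theorem PiecewiseContinuous.matrix_mul {X : ℝ → Matrix (Fin a) (Fin b) ℝ}
    {Y : ℝ → Matrix (Fin b) (Fin c) ℝ} (hX : PiecewiseContinuous X)
    (hY : PiecewiseContinuous Y) : PiecewiseContinuous fun t => X t * Y t :=
  hX.comp₂ hY (h := fun M N => M * N) (continuous_fst.matrix_mul continuous_snd)

theorem PiecewiseContinuous.matrix_transpose {X : ℝ → Matrix (Fin a) (Fin b) ℝ}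
    (hX : PiecewiseContinuous X) : PiecewiseContinuous fun t => (X t)ᵀ :=
  hX.comp (g := fun M : Matrix (Fin a) (Fin b) ℝ => Mᵀ) (continuous_id.matrix_transpose)

theorem PiecewiseContinuous.smul_matrix {f : ℝ → ℝ} {X : ℝ → Matrix (Fin a) (Fin b) ℝ}
    (hf : PiecewiseContinuous f) (hX : PiecewiseContinuous X) :
    PiecewiseContinuous fun t => f t • X t :=
  hf.comp₂ hX (h := fun r M => r • M) continuous_smul

theorem PiecewiseContinuous.trace {X : ℝ → Matrix (Fin a) (Fin a) ℝ}
    (hX : PiecewiseContinuous X) : PiecewiseContinuous fun t => (X t).trace :=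
  hX.comp (g := fun M : Matrix (Fin a) (Fin a) ℝ => M.trace) (continuous_id.matrix_trace)

theorem PiecewiseContinuous.exists_entry_bound {X : ℝ → Matrix (Fin a) (Fin b) ℝ}
    (hX : PiecewiseContinuous X) {T : ℝ} (hT : 0 < T) (hp : Function.Periodic X T) :
    ∃ c, 0 ≤ c ∧ ∀ t i j, |X t i j| ≤ c := by
  have h : ∀ p : Fin a × Fin b, ∃ c, ∀ t, |X t p.1 p.2| ≤ c := fun p =>
    (hX.entry p.1 p.2).exists_bound_of_periodic hT fun t => by simp only [hp t]
  choose c hc using h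
  refine ⟨∑ p, |c p|, Finset.sum_nonneg fun _ _ => abs_nonneg _, fun t i j => ?_⟩
  exact ((hc (i, j) t).trans (le_abs_self _)).trans
    (Finset.single_le_sum (f := fun p => |c p|) (fun _ _ => abs_nonneg _) (Finset.mem_univ (i, j)))

theorem abs_mulVec_apply_le {M : Matrix (Fin a) (Fin b) ℝ} {r : ℝ}
    (hM : ∀ i j, |M i j| ≤ r) (x : Fin b → ℝ) (i : Fin a) : |(M *ᵥ x) i| ≤ b * r * ‖x‖ := by
  calc |(M *ᵥ x) i| = |∑ j, M i j * x j| := rfl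
    _ ≤ ∑ j, |M i j * x j| := Finset.abs_sum_le_sum_abs _ _
    _ ≤ ∑ _j : Fin b, r * ‖x‖ := by
      refine Finset.sum_le_sum fun j _ => ?_
      rw [abs_mul]
      exact mul_le_mul (hM i j) (norm_le_pi_norm x j) (abs_nonneg _)
        ((abs_nonneg _).trans (hM i j))
    _ = b * r * ‖x‖ := by simp; ring

theorem norm_mulVec_le_of_entry_le {M : Matrix (Fin a) (Fin b) ℝ} {r : ℝ} (hr : 0 ≤ r)
    (hM : ∀ i j, |M i j| ≤ r) (x : Fin b → ℝ) : ‖M *ᵥ x‖ ≤ b * r * ‖x‖ := by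
  rw [pi_norm_le_iff_of_nonneg (by positivity)]
  exact abs_mulVec_apply_le hM x

end MatrixPiecewise

/-! ### Entrywise differentiation of matrix functions -/

section EntryDeriv

variable {a b c : ℕ}

/-- Entrywise derivative of a matrix function. -/
def HasEntryDerivAt (X : ℝ → Matrix (Fin a) (Fin b) ℝ) (X' : Matrix (Fin a) (Fin b) ℝ)
    (t : ℝ) : Prop :=
  ∀ i j, HasDerivAt (fun s => X s i j) (X' i j) t

theorem HasEntryDerivAt.congr_deriv {X : ℝ → Matrix (Fin a) (Fin b) ℝ}
    {X' Y' : Matrix (Fin a) (Fin b) ℝ} {t : ℝ} (hX : HasEntryDerivAt X X' t) (h : X' = Y') :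
    HasEntryDerivAt X Y' t :=
  h ▸ hX

theorem HasEntryDerivAt.mul {X : ℝ → Matrix (Fin a) (Fin b) ℝ} {X' : Matrix (Fin a) (Fin b) ℝ}
    {Y : ℝ → Matrix (Fin b) (Fin c) ℝ} {Y' : Matrix (Fin b) (Fin c) ℝ} {t : ℝ}
    (hX : HasEntryDerivAt X X' t) (hY : HasEntryDerivAt Y Y' t) :
    HasEntryDerivAt (fun s => X s * Y s) (X' * Y t + X t * Y') t := fun i j => by
  simp only [Matrix.mul_apply, Matrix.add_apply, ← Finset.sum_add_distrib]
  exact HasDerivAt.fun_sum fun k _ => (hX i k).mul (hY k j)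

theorem HasEntryDerivAt.transpose {X : ℝ → Matrix (Fin a) (Fin b) ℝ}
    {X' : Matrix (Fin a) (Fin b) ℝ} {t : ℝ} (hX : HasEntryDerivAt X X' t) :
    HasEntryDerivAt (fun s => (X s)ᵀ) X'ᵀ t := fun i j => hX j i

theorem HasEntryDerivAt.sub {X Y : ℝ → Matrix (Fin a) (Fin b) ℝ}
    {X' Y' : Matrix (Fin a) (Fin b) ℝ} {t : ℝ} (hX : HasEntryDerivAt X X' t)
    (hY : HasEntryDerivAt Y Y' t) : HasEntryDerivAt (fun s => X s - Y s) (X' - Y') t :=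
  fun i j => (hX i j).sub (hY i j)

theorem HasEntryDerivAt.trace {X : ℝ → Matrix (Fin a) (Fin a) ℝ}
    {X' : Matrix (Fin a) (Fin a) ℝ} {t : ℝ} (hX : HasEntryDerivAt X X' t) :
    HasDerivAt (fun s => (X s).trace) X'.trace t := by
  simp only [Matrix.trace, Matrix.diag]
  exact HasDerivAt.fun_sum fun k _ => hX k k

theorem HasEntryDerivAt.comp_neg {X : ℝ → Matrix (Fin a) (Fin b) ℝ}
    {X' : Matrix (Fin a) (Fin b) ℝ} {t : ℝ} (hX : HasEntryDerivAt X X' (-t)) :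
    HasEntryDerivAt (fun s => X (-s)) (-X') t := fun i j => by
  have h := (hX i j).scomp t (hasDerivAt_neg t)
  exact h.congr_deriv (by simp)

theorem HasEntryDerivAt.mulVec {X : ℝ → Matrix (Fin a) (Fin b) ℝ}
    {X' : Matrix (Fin a) (Fin b) ℝ} {x : ℝ → Fin b → ℝ} {x' : Fin b → ℝ} {t : ℝ}
    (hX : HasEntryDerivAt X X' t) (hx : HasDerivAt x x' t) :
    HasDerivAt (fun s => X s *ᵥ x s) (X' *ᵥ x t + X t *ᵥ x') t := by
  rw [hasDerivAt_pi] at hx ⊢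
  intro i
  simp only [Matrix.mulVec, dotProduct, Pi.add_apply, ← Finset.sum_add_distrib]
  exact HasDerivAt.fun_sum fun k _ => (hX i k).mul (hx k)

theorem hasDerivAt_dotProduct {x y : ℝ → Fin a → ℝ} {x' y' : Fin a → ℝ} {t : ℝ}
    (hx : HasDerivAt x x' t) (hy : HasDerivAt y y' t) :
    HasDerivAt (fun s => x s ⬝ᵥ y s) (x' ⬝ᵥ y t + x t ⬝ᵥ y') t := by
  rw [hasDerivAt_pi] at hx hy
  simp only [dotProduct, ← Finset.sum_add_distrib]
  exact HasDerivAt.fun_sum fun k _ => (hx k).mul (hy k)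

theorem dotProduct_transpose_mulVec (M : Matrix (Fin a) (Fin b) ℝ) (x : Fin b → ℝ)
    (y : Fin a → ℝ) : x ⬝ᵥ (Mᵀ *ᵥ y) = (M *ᵥ x) ⬝ᵥ y := by
  rw [Matrix.dotProduct_mulVec, Matrix.vecMul_transpose]

end EntryDeriv

/-! ### Global solutions of linear equations by contraction -/

section LinearODE

open BoundedContinuousFunction

/-- The rate `2 L` in the weight, twice the Lipschitz constant, is what produces the contraction
factor `1/2`. -/
theorem abs_integral_exp_abs_le {L : ℝ} (hL : 0 < L) (t : ℝ) :
    |∫ s in (0 : ℝ)..t, L * Real.exp (2 * L * |s|)| ≤ Real.exp (2 * L * |t|) / 2 := by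
  have pos : ∀ t : ℝ, 0 ≤ t →
      ∫ s in (0 : ℝ)..t, L * Real.exp (2 * L * |s|) = (Real.exp (2 * L * |t|) - 1) / 2 := by
    intro t ht
    have h1 : ∫ s in (0 : ℝ)..t, L * Real.exp (2 * L * |s|)
        = ∫ s in (0 : ℝ)..t, L * Real.exp (2 * L * s) := by
      refine intervalIntegral.integral_congr fun s hs => ?_
      rw [Set.uIcc_of_le ht] at hs
      simp only [abs_of_nonneg hs.1]
    rw [h1, intervalIntegral.integral_eq_sub_of_hasDerivAt
      (f := fun s => Real.exp (2 * L * s) / 2) (fun s _ => ?_)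
      (Continuous.intervalIntegrable (by fun_prop) _ _), abs_of_nonneg ht]
    · simp; ring
    · have h2 : HasDerivAt (fun s : ℝ => 2 * L * s) (2 * L) s := by
        simpa using (hasDerivAt_id s).const_mul (2 * L)
      exact (h2.exp.div_const 2).congr_deriv (by ring)
  have pos' : ∀ t : ℝ, 0 ≤ t →
      |∫ s in (0 : ℝ)..t, L * Real.exp (2 * L * |s|)| ≤ Real.exp (2 * L * |t|) / 2 := by
    intro t ht
    have h1 : 1 ≤ Real.exp (2 * L * |t|) := Real.one_le_exp (by positivity)
    rw [pos t ht, abs_of_nonneg (by linarith)]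
    linarith
  rcases le_total 0 t with ht | ht
  · exact pos' t ht
  · have h := intervalIntegral.integral_comp_neg (a := 0) (b := -t)
      (f := fun s => L * Real.exp (2 * L * |s|))
    simp only [abs_neg, neg_neg, neg_zero] at h
    rw [intervalIntegral.integral_symm, ← h, abs_neg, ← abs_neg t]
    exact pos' (-t) (by linarith)

variable {n : ℕ} {A : ℝ → Matrix (Fin n) (Fin n) ℝ} {L : ℝ}

theorem intervalIntegrable_mulVec (hA : PiecewiseContinuous A)
    (hL : ∀ t x, ‖A t *ᵥ x‖ ≤ L * ‖x‖) {x : ℝ → Fin n → ℝ} (hx : Continuous x) (a b : ℝ) :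
    IntervalIntegrable (fun s => A s *ᵥ x s) volume a b := by
  refine IntervalIntegrable.mono_fun (g := fun s => A s *ᵥ x s) (f := fun s => L * ‖x s‖)
    (Continuous.intervalIntegrable (by fun_prop) a b) ?_ ?_
  · have : PiecewiseContinuous fun s => A s *ᵥ x s :=
      hA.comp₂ hx.piecewiseContinuous (h := fun M v => M *ᵥ v)
        (continuous_fst.matrix_mulVec continuous_snd)
    exact this.aestronglyMeasurable.restrict
  · exact Eventually.of_forall fun s => (hL s (x s)).trans (le_abs_self _)

/-- The Volterra operator of `x' = A x` in the weighted norm `sup exp (-2 L |t|) ‖x t‖`. -/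
theorem norm_volterra_le (hL0 : 0 < L) (hL : ∀ t x, ‖A t *ᵥ x‖ ≤ L * ‖x‖)
    (y : ℝ →ᵇ (Fin n → ℝ)) (t : ℝ) :
    ‖Real.exp (-(2 * L * |t|)) •
      ∫ s in (0 : ℝ)..t, A s *ᵥ (Real.exp (2 * L * |s|) • y s)‖ ≤ 1 / 2 * ‖y‖ := by
  have h1 : ‖∫ s in (0 : ℝ)..t, A s *ᵥ (Real.exp (2 * L * |s|) • y s)‖
      ≤ |∫ s in (0 : ℝ)..t, (L * Real.exp (2 * L * |s|)) * ‖y‖| := by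
    refine intervalIntegral.norm_integral_le_abs_of_norm_le (Eventually.of_forall fun s => ?_)
      (Continuous.intervalIntegrable (by fun_prop) _ _)
    refine (hL s _).trans ?_
    rw [norm_smul, Real.norm_eq_abs, Real.abs_exp, ← mul_assoc]
    gcongr
    exact y.norm_coe_le_norm s
  rw [intervalIntegral.integral_mul_const, abs_mul, abs_norm] at h1
  have h2 := mul_le_mul_of_nonneg_right (abs_integral_exp_abs_le hL0 t) (norm_nonneg y)
  rw [norm_smul, Real.norm_eq_abs, Real.abs_exp]
  calc _ ≤ Real.exp (-(2 * L * |t|)) * (Real.exp (2 * L * |t|) / 2 * ‖y‖) := by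
        gcongr
        exact h1.trans h2
    _ = Real.exp (-(2 * L * |t|) + 2 * L * |t|) * (1 / 2 * ‖y‖) := by rw [Real.exp_add]; ring
    _ = 1 / 2 * ‖y‖ := by simp

/-- Writing `x = exp (2 L |t|) y` with `y` bounded and continuous turns the integral equation into a
fixed-point problem for a contraction on the whole line, so no continuation of local solutions is
needed. -/
theorem exists_integral_solution (hA : PiecewiseContinuous A) (hL0 : 0 < L)
    (hL : ∀ t x, ‖A t *ᵥ x‖ ≤ L * ‖x‖) (x₀ : Fin n → ℝ) :
    ∃ x : ℝ → Fin n → ℝ, Continuous x ∧ ∀ t, x t = x₀ + ∫ s in (0 : ℝ)..t, A s *ᵥ x s := by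
  have hexp : ∀ y : ℝ →ᵇ (Fin n → ℝ), Continuous fun s => Real.exp (2 * L * |s|) • y s :=
    fun y => by fun_prop
  have hcont : ∀ y : ℝ →ᵇ (Fin n → ℝ), Continuous fun t => Real.exp (-(2 * L * |t|)) •
      (x₀ + ∫ s in (0 : ℝ)..t, A s *ᵥ (Real.exp (2 * L * |s|) • y s)) := fun y => by
    refine Continuous.smul (f := fun t : ℝ => Real.exp (-(2 * L * |t|))) (by fun_prop)
      (continuous_const.add ?_)
    exact intervalIntegral.continuous_primitive
      (fun a b => intervalIntegrable_mulVec hA hL (hexp y) a b) 0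
  have hbdd : ∀ (y : ℝ →ᵇ (Fin n → ℝ)) (t : ℝ), ‖Real.exp (-(2 * L * |t|)) •
      (x₀ + ∫ s in (0 : ℝ)..t, A s *ᵥ (Real.exp (2 * L * |s|) • y s))‖
        ≤ ‖x₀‖ + 1 / 2 * ‖y‖ := fun y t => by
    rw [smul_add]
    refine (norm_add_le _ _).trans (add_le_add ?_ (norm_volterra_le hL0 hL y t))
    rw [norm_smul, Real.norm_eq_abs, Real.abs_exp]
    refine mul_le_of_le_one_left (norm_nonneg _) (Real.exp_le_one_iff.mpr ?_)
    have : 0 ≤ 2 * L * |t| := by positivity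
    linarith
  let F : (ℝ →ᵇ (Fin n → ℝ)) → (ℝ →ᵇ (Fin n → ℝ)) := fun y =>
    BoundedContinuousFunction.ofNormedAddCommGroup _ (hcont y) _ (hbdd y)
  have hF : ContractingWith (1 / 2) F := by
    refine ⟨by rw [← NNReal.coe_lt_coe]; norm_num, LipschitzWith.of_dist_le_mul fun y z => ?_⟩
    refine (BoundedContinuousFunction.dist_le (by positivity)).mpr fun t => ?_
    have h := norm_volterra_le hL0 hL (y - z) t
    have hi : ∀ w : ℝ →ᵇ (Fin n → ℝ), IntervalIntegrable
        (fun s => A s *ᵥ (Real.exp (2 * L * |s|) • w s)) volume 0 t :=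
      fun w => intervalIntegrable_mulVec hA hL (hexp w) 0 t
    have e : F y t - F z t = Real.exp (-(2 * L * |t|)) •
      ∫ s in (0 : ℝ)..t, A s *ᵥ (Real.exp (2 * L * |s|) • (y - z) s) := by
      simp only [BoundedContinuousFunction.coe_sub, Pi.sub_apply, smul_sub, Matrix.mulVec_sub]
      rw [intervalIntegral.integral_sub (hi y) (hi z), smul_sub]
      change Real.exp (-(2 * L * |t|)) • (x₀ + _) - Real.exp (-(2 * L * |t|)) • (x₀ + _) = _
      rw [smul_add, smul_add]
      abel
    rw [dist_eq_norm, e, dist_eq_norm]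
    exact_mod_cast h
  obtain ⟨y, hy, -⟩ := hF.exists_fixedPoint 0 (edist_ne_top _ _)
  refine ⟨fun t => Real.exp (2 * L * |t|) • y t, by fun_prop, fun t => ?_⟩
  have h : y t = Real.exp (-(2 * L * |t|)) •
      (x₀ + ∫ s in (0 : ℝ)..t, A s *ᵥ (Real.exp (2 * L * |s|) • y s)) := by
    conv_lhs => rw [← hy.eq]
    rfl
  simp only
  rw [h, smul_smul, ← Real.exp_add]
  simp

end LinearODE

/-! ### Fundamental matrices and uniqueness of trajectories -/

section Fundamental

variable {n : ℕ} {A : ℝ → Matrix (Fin n) (Fin n) ℝ}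

theorem exists_trajectory (hA : PiecewiseContinuous A) {r : ℝ} (hr : 0 ≤ r)
    (hb : ∀ t i j, |A t i j| ≤ r) (x₀ : Fin n → ℝ) :
    ∃ x, IsTrajectory A x ∧ x 0 = x₀ := by
  have hL : ∀ t x, ‖A t *ᵥ x‖ ≤ (n * r + 1) * ‖x‖ := fun t x =>
    (norm_mulVec_le_of_entry_le hr (hb t) x).trans
      (mul_le_mul_of_nonneg_right (by linarith) (norm_nonneg x))
  obtain ⟨x, hx, he⟩ := exists_integral_solution hA (by positivity) hL x₀
  refine ⟨x, ⟨hx, ?_⟩, by rw [he 0]; simp⟩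
  obtain ⟨S, hS, hc⟩ := hA.1
  refine ⟨S, hS, fun t ht => ?_⟩
  have hpc : PiecewiseContinuous fun s => A s *ᵥ x s :=
    hA.comp₂ hx.piecewiseContinuous (h := fun M v => M *ᵥ v)
      (continuous_fst.matrix_mulVec continuous_snd)
  have h := intervalIntegral.integral_hasDerivAt_right (intervalIntegrable_mulVec hA hL hx 0 t)
    ⟨Set.univ, univ_mem, by simpa using hpc.aestronglyMeasurable⟩
    ((by fun_prop : Continuous fun p : Matrix (Fin n) (Fin n) ℝ × (Fin n → ℝ) =>
      p.1 *ᵥ p.2).continuousAt.comp ((hc t ht).prodMk hx.continuousAt))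
  have h2 := h.const_add x₀
  exact h2.congr_of_eventuallyEq (Eventually.of_forall he)

/-- `Φ` is the fundamental matrix of `x' = A x` normalized at `0` and `Ψ` is its inverse. -/
structure IsFundamental (A Φ Ψ : ℝ → Matrix (Fin n) (Fin n) ℝ) : Prop where
  cont : Continuous Φ
  cont_inv : Continuous Ψ
  deriv : ∃ S, LocallyFiniteSet S ∧ ∀ t, t ∉ S →
    HasEntryDerivAt Φ (A t * Φ t) t ∧ HasEntryDerivAt Ψ (-(Ψ t * A t)) t
  inv_mul : ∀ t, Ψ t * Φ t = 1
  mul_inv : ∀ t, Φ t * Ψ t = 1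

theorem exists_matrix_trajectory (hA : PiecewiseContinuous A) {r : ℝ} (hr : 0 ≤ r)
    (hb : ∀ t i j, |A t i j| ≤ r) :
    ∃ Φ : ℝ → Matrix (Fin n) (Fin n) ℝ, Continuous Φ ∧ Φ 0 = 1 ∧
      ∃ S, LocallyFiniteSet S ∧ ∀ t, t ∉ S → HasEntryDerivAt Φ (A t * Φ t) t := by
  choose x hx hx0 using fun j : Fin n => exists_trajectory hA hr hb (Pi.single j 1)
  choose hxc S hS hd using hx
  refine ⟨fun t => Matrix.of fun i j => x j t i, ?_, ?_, ⋃ j, S j, ?_, ?_⟩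
  · refine continuous_matrix fun i j => ?_
    exact (continuous_apply i).comp (hxc j)
  · ext i j
    simp [hx0, Matrix.one_apply, Pi.single_apply]
  · intro a b
    rw [Set.iUnion_inter]
    exact Set.finite_iUnion fun j => hS j a b
  · intro t ht i j
    rw [Set.mem_iUnion, not_exists] at ht
    have := hasDerivAt_pi.mp (hd j t (ht j)) i
    simpa [Matrix.mul_apply, Matrix.mulVec, dotProduct] using this

theorem eq_of_entryDeriv_zero {a b : ℕ} {X : ℝ → Matrix (Fin a) (Fin b) ℝ} (hX : Continuous X)
    {S : Set ℝ} (hS : LocallyFiniteSet S) (hd : ∀ t, t ∉ S → HasEntryDerivAt X 0 t) (s t : ℝ) :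
    X s = X t := by
  ext i j
  exact hS.eq_of_deriv_zero (g := fun t => X t i j) (hX.matrix_elem i j)
    (fun t ht => hd t ht i j) s t

/-- The inverse is the transpose of the fundamental matrix of the adjoint equation `y' = -Aᵀ y`: the
product has zero derivative and equals `1` at time `0`. -/
theorem exists_isFundamental (hA : PiecewiseContinuous A) {T : ℝ} (hT : 0 < T)
    (hp : Function.Periodic A T) : ∃ Φ Ψ, IsFundamental A Φ Ψ := by
  obtain ⟨r, hr, hb⟩ := hA.exists_entry_bound hT hp
  obtain ⟨Φ, hΦ, hΦ0, S, hS, hd⟩ := exists_matrix_trajectory hA hr hb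
  obtain ⟨Y, hY, hY0, S', hS', hd'⟩ := exists_matrix_trajectory (A := fun t => -(A t)ᵀ)
    (hA.matrix_transpose.neg) hr (fun t i j => by simpa using hb t j i)
  have hΨ : ∀ t, t ∉ S' → HasEntryDerivAt (fun t => (Y t)ᵀ) (-((Y t)ᵀ * A t)) t := by
    intro t ht
    have := (hd' t ht).transpose
    simpa [Matrix.transpose_mul] using this
  have hinv : ∀ t, (Y t)ᵀ * Φ t = 1 := fun t => by
    have := eq_of_entryDeriv_zero (X := fun t => (Y t)ᵀ * Φ t)
      (hY.matrix_transpose.matrix_mul hΦ) (hS.union hS') (fun t ht => by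
        rw [Set.mem_union, not_or] at ht
        have := (hΨ t ht.2).mul (hd t ht.1)
        simpa [Matrix.mul_assoc] using this) t 0
    rw [this, hΦ0, hY0]
    simp
  refine ⟨Φ, fun t => (Y t)ᵀ, hΦ, hY.matrix_transpose, ⟨S ∪ S', hS.union hS', ?_⟩, hinv,
    fun t => mul_eq_one_comm.mp (hinv t)⟩
  intro t ht
  rw [Set.mem_union, not_or] at ht
  exact ⟨hd t ht.1, hΨ t ht.2⟩

variable {Φ Ψ : ℝ → Matrix (Fin n) (Fin n) ℝ}

theorem IsFundamental.isTrajectory (h : IsFundamental A Φ Ψ) (v : Fin n → ℝ) :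
    IsTrajectory A fun t => Φ t *ᵥ v := by
  refine ⟨h.cont.matrix_mulVec continuous_const, ?_⟩
  obtain ⟨S, hS, hd⟩ := h.deriv
  refine ⟨S, hS, fun t ht => ?_⟩
  have := (hd t ht).1.mulVec (hasDerivAt_const t v)
  simpa using this

/-- Variation of constants: the two derivative terms cancel. Uniqueness of trajectories follows from
this. -/
theorem IsFundamental.inv_mulVec_eq (h : IsFundamental A Φ Ψ) {x : ℝ → Fin n → ℝ}
    (hx : IsTrajectory A x) (s t : ℝ) : Ψ s *ᵥ x s = Ψ t *ᵥ x t := by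
  obtain ⟨hxc, S, hS, hd⟩ := hx
  obtain ⟨S', hS', hd'⟩ := h.deriv
  ext i
  refine (hS.union hS').eq_of_deriv_zero (g := fun t => (Ψ t *ᵥ x t) i)
    ((continuous_apply i).comp (h.cont_inv.matrix_mulVec hxc)) (fun t ht => ?_) s t
  rw [Set.mem_union, not_or] at ht
  have := hasDerivAt_pi.mp ((hd' t ht.2).2.mulVec (hd t ht.1)) i
  refine this.congr_deriv ?_
  rw [Matrix.neg_mulVec, Matrix.mulVec_mulVec]
  simp

theorem IsFundamental.trajectory_eq (h : IsFundamental A Φ Ψ) {x : ℝ → Fin n → ℝ}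
    (hx : IsTrajectory A x) (s t : ℝ) : x t = (Φ t * Ψ s) *ᵥ x s := by
  rw [← Matrix.mulVec_mulVec, h.inv_mulVec_eq hx s t, Matrix.mulVec_mulVec, h.mul_inv,
    Matrix.one_mulVec]

theorem IsFundamental.exists_trajectory_through (h : IsFundamental A Φ Ψ) (s : ℝ)
    (v : Fin n → ℝ) : IsTrajectory A (fun t => (Φ t * Ψ s) *ᵥ v) ∧ (Φ s * Ψ s) *ᵥ v = v := by
  refine ⟨?_, by rw [h.mul_inv, Matrix.one_mulVec]⟩
  have := h.isTrajectory (Ψ s *ᵥ v)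
  simpa only [Matrix.mulVec_mulVec] using this

theorem IsTrajectory.translate {x : ℝ → Fin n → ℝ} (hx : IsTrajectory A x) {c : ℝ}
    (hp : Function.Periodic A c) : IsTrajectory A fun t => x (t + c) := by
  obtain ⟨hxc, S, hS, hd⟩ := hx
  refine ⟨hxc.comp (by fun_prop), _, hS.translate c, fun t ht => ?_⟩
  have := HasDerivAt.comp_add_const t c (hd (t + c) ht)
  rwa [hp t] at this

theorem IsFundamental.transition_periodic (h : IsFundamental A Φ Ψ) {T : ℝ}
    (hp : Function.Periodic A T) (s t : ℝ) : Φ (s + T) * Ψ (t + T) = Φ s * Ψ t := by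
  refine Matrix.ext_of_mulVec_single fun i => ?_
  have h1 := (h.exists_trajectory_through (t + T) (Pi.single i 1)).1.translate hp
  have h2 := h.trajectory_eq h1 t s
  rw [h.mul_inv (t + T), Matrix.one_mulVec] at h2
  exact h2

end Fundamental

/-! ### Real quadratic forms -/

section Quadratic

variable {n m : ℕ}

theorem posSemidef_iff_real {M : Matrix (Fin n) (Fin n) ℝ} :
    M.PosSemidef ↔ Mᵀ = M ∧ ∀ x : Fin n → ℝ, 0 ≤ x ⬝ᵥ (M *ᵥ x) := by
  rw [Matrix.posSemidef_iff_dotProduct_mulVec]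
  simp only [star_trivial, Matrix.IsHermitian, Matrix.conjTranspose_eq_transpose_of_trivial]

theorem posDef_iff_real {M : Matrix (Fin n) (Fin n) ℝ} :
    M.PosDef ↔ Mᵀ = M ∧ ∀ x : Fin n → ℝ, x ≠ 0 → 0 < x ⬝ᵥ (M *ᵥ x) := by
  rw [Matrix.posDef_iff_dotProduct_mulVec]
  simp only [star_trivial, Matrix.IsHermitian, Matrix.conjTranspose_eq_transpose_of_trivial]

theorem posSemidef_transpose_mul_self (M : Matrix (Fin m) (Fin n) ℝ) : (Mᵀ * M).PosSemidef := by
  simpa using Matrix.posSemidef_conjTranspose_mul_self M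

theorem posSemidef_mul_transpose_self (M : Matrix (Fin m) (Fin n) ℝ) : (M * Mᵀ).PosSemidef := by
  simpa using Matrix.posSemidef_self_mul_conjTranspose M

theorem dotProduct_gram_mulVec (M : Matrix (Fin m) (Fin n) ℝ) (x : Fin n → ℝ) :
    x ⬝ᵥ ((Mᵀ * M) *ᵥ x) = (M *ᵥ x) ⬝ᵥ (M *ᵥ x) := by
  rw [← Matrix.mulVec_mulVec, dotProduct_transpose_mulVec]

theorem dotProduct_self_nonneg_real (x : Fin n → ℝ) : 0 ≤ x ⬝ᵥ x :=
  Finset.sum_nonneg fun i _ => mul_self_nonneg (x i)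

theorem abs_dotProduct_le (x y : Fin n → ℝ) : |x ⬝ᵥ y| ≤ n * (‖x‖ * ‖y‖) := by
  calc |x ⬝ᵥ y| ≤ ∑ i, |x i * y i| := Finset.abs_sum_le_sum_abs _ _
    _ ≤ ∑ _i : Fin n, ‖x‖ * ‖y‖ := Finset.sum_le_sum fun i _ => by
        rw [abs_mul]
        exact mul_le_mul (norm_le_pi_norm x i) (norm_le_pi_norm y i) (abs_nonneg _)
          (norm_nonneg _)
    _ = n * (‖x‖ * ‖y‖) := by simp

theorem abs_quadratic_le {M : Matrix (Fin n) (Fin n) ℝ} {r : ℝ} (hr : 0 ≤ r)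
    (hM : ∀ i j, |M i j| ≤ r) (x : Fin n → ℝ) :
    |x ⬝ᵥ (M *ᵥ x)| ≤ (n * n * r) * ‖x‖ ^ 2 := by
  calc |x ⬝ᵥ (M *ᵥ x)| ≤ n * (‖x‖ * ‖M *ᵥ x‖) := abs_dotProduct_le _ _
    _ ≤ n * (‖x‖ * (n * r * ‖x‖)) := by
        gcongr
        exact norm_mulVec_le_of_entry_le hr hM x
    _ = (n * n * r) * ‖x‖ ^ 2 := by ring

theorem entry_eq_dotProduct (M : Matrix (Fin m) (Fin n) ℝ) (i : Fin m) (j : Fin n) :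
    M i j = (Pi.single i 1 : Fin m → ℝ) ⬝ᵥ (M *ᵥ Pi.single j 1) := by
  simp

end Quadratic

/-! ### Backward Lyapunov equation: dissipation and comparison -/

section Lyapunov

variable {n : ℕ}

/-- `Q` solves the backward Lyapunov equation `-Q' = Q A + Aᵀ Q + W`. -/
abbrev IsLyapunov (A W Q : ℝ → Matrix (Fin n) (Fin n) ℝ) : Prop :=
  IsMatrixSolution (fun t X => -(X * A t + (A t)ᵀ * X + W t)) Q

variable {A W Q : ℝ → Matrix (Fin n) (Fin n) ℝ}

/-- The terms of the equation containing `A` cancel against the motion of `x`; only the running cost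
`W` remains. -/
theorem IsLyapunov.hasDerivAt_quadratic (hQ : IsLyapunov A W Q) {x : ℝ → Fin n → ℝ}
    (hx : IsTrajectory A x) : ∃ S, LocallyFiniteSet S ∧ ∀ t, t ∉ S →
      HasDerivAt (fun s => x s ⬝ᵥ (Q s *ᵥ x s)) (-(x t ⬝ᵥ (W t *ᵥ x t))) t := by
  obtain ⟨-, S, hS, hd⟩ := hQ
  obtain ⟨-, S', hS', hd'⟩ := hx
  refine ⟨S ∪ S', hS.union hS', fun t ht => ?_⟩
  rw [Set.mem_union, not_or] at ht
  have h := hasDerivAt_dotProduct (hd' t ht.2)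
    (HasEntryDerivAt.mulVec (X := Q) (hd t ht.1) (hd' t ht.2))
  refine h.congr_deriv ?_
  simp only [Matrix.neg_mulVec, Matrix.add_mulVec, ← Matrix.mulVec_mulVec, dotProduct_add,
    dotProduct_neg, dotProduct_transpose_mulVec]
  ring

theorem IsMatrixSolution.continuous_quadratic {F} (hQ : IsMatrixSolution F Q) {x : ℝ → Fin n → ℝ}
    (hx : IsTrajectory A x) : Continuous fun s => x s ⬝ᵥ (Q s *ᵥ x s) :=
  hx.1.dotProduct (hQ.1.matrix_mulVec hx.1)

theorem IsLyapunov.antitone_quadratic (hQ : IsLyapunov A W Q)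
    (hW : ∀ t, (W t).PosSemidef) {x : ℝ → Fin n → ℝ} (hx : IsTrajectory A x) :
    Antitone fun s => x s ⬝ᵥ (Q s *ᵥ x s) := fun s t hst => by
  obtain ⟨S, hS, hd⟩ := hQ.hasDerivAt_quadratic hx
  exact hS.le_of_deriv_nonpos (hQ.continuous_quadratic hx) hst fun u _ hu =>
    ⟨_, neg_nonpos.mpr ((posSemidef_iff_real.mp (hW u)).2 _), hd u hu⟩

theorem ExponentiallyStable.tendsto_norm (hA : ExponentiallyStable A) {x : ℝ → Fin n → ℝ}
    (hx : IsTrajectory A x) : Tendsto (fun t => ‖x t‖) atTop (𝓝 0) := by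
  obtain ⟨M, lam, hlam, h⟩ := hA
  have h1 : Tendsto (fun t : ℝ => M * Real.exp (-lam * (t - 0)) * ‖x 0‖) atTop (𝓝 0) := by
    have h2 : Tendsto (fun t : ℝ => Real.exp (-(lam * t))) atTop (𝓝 0) :=
      Real.tendsto_exp_neg_atTop_nhds_zero.comp (tendsto_id.const_mul_atTop hlam)
    have h3 := (h2.const_mul M).mul_const ‖x 0‖
    simpa using h3
  refine squeeze_zero' (Eventually.of_forall fun t => norm_nonneg _) ?_ h1
  filter_upwards [eventually_ge_atTop (0 : ℝ)] with t ht
  exact h x hx 0 t ht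

theorem IsMatrixSolution.exists_entry_bound {F} (hQ : IsMatrixSolution F Q) {T : ℝ} (hT : 0 < T)
    (hp : Function.Periodic Q T) : ∃ c, 0 ≤ c ∧ ∀ t i j, |Q t i j| ≤ c :=
  hQ.1.piecewiseContinuous.exists_entry_bound hT hp

/-- Comparison principle for the Lyapunov equation of a stable system. -/
theorem IsLyapunov.quadratic_nonneg (hQ : IsLyapunov A W Q) {T : ℝ} (hT : 0 < T)
    (hA : PiecewiseContinuous A) (hAp : Function.Periodic A T) (hst : ExponentiallyStable A)
    (hQp : Function.Periodic Q T) (hW : ∀ t, (W t).PosSemidef) (t : ℝ) (v : Fin n → ℝ) :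
    0 ≤ v ⬝ᵥ (Q t *ᵥ v) := by
  obtain ⟨Φ, Ψ, hΦ⟩ := exists_isFundamental hA hT hAp
  obtain ⟨hx, hv⟩ := hΦ.exists_trajectory_through t v
  set x := fun s => (Φ s * Ψ t) *ᵥ v
  obtain ⟨c, hc0, hc⟩ := hQ.exists_entry_bound hT hQp
  have hlim : Tendsto (fun s => x s ⬝ᵥ (Q s *ᵥ x s)) atTop (𝓝 0) := by
    refine squeeze_zero_norm (fun s => abs_quadratic_le hc0 (hc s) (x s)) ?_
    simpa using ((hst.tendsto_norm hx).pow 2).const_mul (n * n * c)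
  -- A nonincreasing function that tends to `0` is nonnegative; the limit is `0` since `Q` is
  -- bounded and the trajectory decays.
  have h := (hQ.antitone_quadratic hW hx).le_of_tendsto hlim t
  simpa only [x, hv] using h

theorem symm_eq_zero_of_quadratic {M : Matrix (Fin n) (Fin n) ℝ} (hs : Mᵀ = M)
    (h : ∀ v : Fin n → ℝ, v ⬝ᵥ (M *ᵥ v) = 0) : M = 0 := by
  have hp : ∀ u v : Fin n → ℝ, u ⬝ᵥ (M *ᵥ v) = 0 := fun u v => by
    have h1 := h (u + v)
    have h2 : v ⬝ᵥ (M *ᵥ u) = u ⬝ᵥ (M *ᵥ v) := by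
      conv_lhs => rw [← hs, dotProduct_transpose_mulVec, dotProduct_comm]
    simp only [Matrix.mulVec_add, dotProduct_add, add_dotProduct, h u, h v, h2] at h1
    linarith
  ext i j
  rw [entry_eq_dotProduct M i j, hp, Matrix.zero_apply]

theorem IsLyapunov.sub {W' Q' : ℝ → Matrix (Fin n) (Fin n) ℝ} (hQ : IsLyapunov A W Q)
    (hQ' : IsLyapunov A W' Q') : IsLyapunov A (fun t => W t - W' t) fun t => Q t - Q' t := by
  obtain ⟨hc, S, hS, hd⟩ := hQ
  obtain ⟨hc', S', hS', hd'⟩ := hQ'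
  refine ⟨hc.sub hc', S ∪ S', hS.union hS', fun t ht => ?_⟩
  rw [Set.mem_union, not_or] at ht
  have h := HasEntryDerivAt.sub (X := Q) (Y := Q') (hd t ht.1) (hd' t ht.2)
  refine h.congr_deriv ?_
  simp only [Matrix.sub_mul, Matrix.mul_sub]
  abel

theorem IsLyapunov.congr {A' W' : ℝ → Matrix (Fin n) (Fin n) ℝ} (hQ : IsLyapunov A W Q)
    (h : ∀ t, Q t * A t + (A t)ᵀ * Q t + W t = Q t * A' t + (A' t)ᵀ * Q t + W' t) :
    IsLyapunov A' W' Q := by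
  obtain ⟨hc, S, hS, hd⟩ := hQ
  refine ⟨hc, S, hS, fun t ht i j => (hd t ht i j).congr_deriv ?_⟩
  dsimp only
  rw [h t]

/-- Monotonicity of the periodic solution of the Lyapunov equation in the inhomogeneity. -/
theorem IsLyapunov.quadratic_le {W' Q' : ℝ → Matrix (Fin n) (Fin n) ℝ} (hQ : IsLyapunov A W Q)
    (hQ' : IsLyapunov A W' Q') {T : ℝ} (hT : 0 < T)
    (hA : PiecewiseContinuous A) (hAp : Function.Periodic A T) (hst : ExponentiallyStable A)
    (hQp : Function.Periodic Q T) (hQp' : Function.Periodic Q' T)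
    (hW : ∀ t, (W t - W' t).PosSemidef) (t : ℝ) (v : Fin n → ℝ) :
    v ⬝ᵥ (Q' t *ᵥ v) ≤ v ⬝ᵥ (Q t *ᵥ v) := by
  have h := (hQ.sub hQ').quadratic_nonneg hT hA hAp hst (hQp.sub hQp') hW t v
  rw [Matrix.sub_mulVec, dotProduct_sub] at h
  linarith

theorem eq_of_quadratic_eq {M N : Matrix (Fin n) (Fin n) ℝ} (hM : Mᵀ = M) (hN : Nᵀ = N)
    (h : ∀ v : Fin n → ℝ, v ⬝ᵥ (M *ᵥ v) = v ⬝ᵥ (N *ᵥ v)) : M = N := by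
  rw [← sub_eq_zero]
  refine symm_eq_zero_of_quadratic (by rw [Matrix.transpose_sub, hM, hN]) fun v => ?_
  rw [Matrix.sub_mulVec, dotProduct_sub, h v, sub_self]

/-- Comparison in both directions. Symmetry is needed because a quadratic form only sees the
symmetric part. -/
theorem IsLyapunov.unique {Q' : ℝ → Matrix (Fin n) (Fin n) ℝ} (hQ : IsLyapunov A W Q)
    (hQ' : IsLyapunov A W Q') {T : ℝ} (hT : 0 < T)
    (hA : PiecewiseContinuous A) (hAp : Function.Periodic A T) (hst : ExponentiallyStable A)
    (hQp : Function.Periodic Q T) (hQp' : Function.Periodic Q' T)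
    (hs : ∀ t, (Q t)ᵀ = Q t) (hs' : ∀ t, (Q' t)ᵀ = Q' t) : Q = Q' := by
  have hW : ∀ t, (W t - W t).PosSemidef := fun t => by
    rw [sub_self]; exact Matrix.PosSemidef.zero
  funext t
  exact eq_of_quadratic_eq (hs t) (hs' t) fun v => le_antisymm
    (hQ'.quadratic_le hQ hT hA hAp hst hQp' hQp hW t v)
    (hQ.quadratic_le hQ' hT hA hAp hst hQp hQp' hW t v)

end Lyapunov

/-! ### Periodic solutions of the stable Lyapunov equation -/

section Existence

variable {n : ℕ} {A W : ℝ → Matrix (Fin n) (Fin n) ℝ}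

theorem abs_mul_entry_le {a b c : ℕ} {X : Matrix (Fin a) (Fin b) ℝ} {Y : Matrix (Fin b) (Fin c) ℝ}
    {r s : ℝ} (hX : ∀ i j, |X i j| ≤ r) (hY : ∀ i j, |Y i j| ≤ s) (i : Fin a) (j : Fin c) :
    |(X * Y) i j| ≤ b * (r * s) := by
  rw [Matrix.mul_apply]
  calc |∑ k, X i k * Y k j| ≤ ∑ k, |X i k * Y k j| := Finset.abs_sum_le_sum_abs _ _
    _ ≤ ∑ _k : Fin b, r * s := Finset.sum_le_sum fun k _ => by
        rw [abs_mul]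
        exact mul_le_mul (hX i k) (hY k j) (abs_nonneg _) ((abs_nonneg _).trans (hX i k))
    _ = b * (r * s) := by simp

theorem IsFundamental.entry_decay {Φ Ψ : ℝ → Matrix (Fin n) (Fin n) ℝ}
    (hΦ : IsFundamental A Φ Ψ) (hst : ExponentiallyStable A) :
    ∃ c lam : ℝ, 0 < lam ∧ ∀ s, 0 ≤ s → ∀ i j, |Φ s i j| ≤ c * Real.exp (-lam * s) := by
  obtain ⟨M, lam, hlam, h⟩ := hst
  obtain ⟨c, hc⟩ : ∃ c, ∀ j : Fin n, M * ‖Φ 0 *ᵥ (Pi.single j 1 : Fin n → ℝ)‖ ≤ c := by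
    obtain ⟨c, hc⟩ := (Set.finite_range
      fun j : Fin n => M * ‖Φ 0 *ᵥ (Pi.single j 1 : Fin n → ℝ)‖).bddAbove
    exact ⟨c, fun j => hc ⟨j, rfl⟩⟩
  refine ⟨c, lam, hlam, fun s hs i j => ?_⟩
  have h1 := h _ (hΦ.isTrajectory (Pi.single j 1)) 0 s hs
  have h2 := norm_le_pi_norm (Φ s *ᵥ (Pi.single j 1 : Fin n → ℝ)) i
  have h3 : (Φ s *ᵥ (Pi.single j 1 : Fin n → ℝ)) i = Φ s i j := by simp
  rw [h3, Real.norm_eq_abs] at h2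
  refine h2.trans (h1.trans ?_)
  rw [sub_zero, mul_right_comm]
  exact mul_le_mul_of_nonneg_right (hc j) (Real.exp_nonneg _)

theorem dotProduct_integral_mulVec {H : ℝ → Matrix (Fin n) (Fin n) ℝ} {s : Set ℝ}
    (hH : ∀ i j, IntegrableOn (fun t => H t i j) s) (u v : Fin n → ℝ) :
    u ⬝ᵥ ((Matrix.of fun i j => ∫ t in s, H t i j) *ᵥ v) = ∫ t in s, u ⬝ᵥ (H t *ᵥ v) := by
  simp only [dotProduct, Matrix.mulVec, Matrix.of_apply]
  rw [integral_finsetSum]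
  · refine Finset.sum_congr rfl fun i _ => ?_
    rw [integral_const_mul, integral_finsetSum]
    · congr 1
      exact Finset.sum_congr rfl fun j _ => (integral_mul_const _ _).symm
    · exact fun j _ => (hH i j).mul_const _
  · exact fun i _ => (integrable_finsetSum _ fun j _ => (hH i j).mul_const _).const_mul _

/-- A stable periodic Lyapunov equation has a positive semidefinite periodic solution. -/
theorem exists_isLyapunov {T : ℝ} (hT : 0 < T) (hA : PiecewiseContinuous A)
    (hAp : Function.Periodic A T) (hst : ExponentiallyStable A) (hWc : PiecewiseContinuous W)
    (hWp : Function.Periodic W T) (hW : ∀ t, (W t).PosSemidef) :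
    ∃ Q, IsLyapunov A W Q ∧ Function.Periodic Q T ∧ ∀ t, (Q t).PosSemidef := by
  obtain ⟨Φ, Ψ, hΦ⟩ := exists_isFundamental hA hT hAp
  obtain ⟨c, lam, hlam, hdec⟩ := hΦ.entry_decay hst
  obtain ⟨w, hw0, hw⟩ := hWc.exists_entry_bound hT hWp
  set H : ℝ → Matrix (Fin n) (Fin n) ℝ := fun s => (Φ s)ᵀ * W s * Φ s with hH
  have hHc : PiecewiseContinuous H :=
    (hΦ.cont.matrix_transpose.piecewiseContinuous.matrix_mul hWc).matrix_mul
      hΦ.cont.piecewiseContinuous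
  have hint0 : ∀ i j, IntegrableOn (fun s => H s i j) (Set.Ioi 0) := fun i j => by
    have hexp := (integrableOn_exp_mul_Ioi (a := -lam + -lam) (by linarith) 0).const_mul
      (n * (n * (c * w) * c))
    refine Integrable.mono' hexp (hHc.entry i j).aestronglyMeasurable.restrict ?_
    rw [ae_restrict_iff' measurableSet_Ioi]
    refine Eventually.of_forall fun s hs => ?_
    have h1 := abs_mul_entry_le (abs_mul_entry_le (X := (Φ s)ᵀ)
      (fun i j => hdec s (le_of_lt hs) j i) (hw s)) (hdec s (le_of_lt hs)) i j
    refine h1.trans (le_of_eq ?_)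
    rw [add_mul, Real.exp_add]
    ring
  have hint : ∀ t i j, IntegrableOn (fun s => H s i j) (Set.Ioi t) := fun t i j => by
    have h1 : IntegrableOn (fun s => H s i j) (Set.Ioc t (max t 0)) :=
      ((hHc.entry i j).intervalIntegrable t (max t 0)).1
    have h2 := h1.union ((hint0 i j).mono_set (Set.Ioi_subset_Ioi (le_max_right t 0)))
    rwa [Set.Ioc_union_Ioi_eq_Ioi (le_max_left _ _)] at h2
  -- The solution is the cost-to-go `∫ₜ^∞ Φᵀ W Φ`, pulled back to time `t` by `Ψ t`. Integrating
  -- against the fixed `Φ` keeps the integrand independent of `t`.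
  set G : ℝ → Matrix (Fin n) (Fin n) ℝ :=
    fun t => Matrix.of fun i j => ∫ s in Set.Ioi t, H s i j with hG
  have hGe : ∀ i j, (fun t => G t i j) = fun t => G 0 i j - ∫ s in (0 : ℝ)..t, H s i j := by
    intro i j
    funext t
    have h := intervalIntegral.integral_Ioi_sub_Ioi' (hint 0 i j) (hint t i j)
    rw [← h]
    simp [hG]
  have hGc : Continuous G := continuous_matrix fun i j => by
    rw [hGe i j]
    exact continuous_const.sub ((hHc.entry i j).continuous_integral 0)
  obtain ⟨S, hS, hd⟩ := hΦ.deriv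
  obtain ⟨S', hS', hd'⟩ := hHc.1
  have hquad : ∀ t (u v : Fin n → ℝ), u ⬝ᵥ (G t *ᵥ v) = ∫ s in Set.Ioi t, u ⬝ᵥ (H s *ᵥ v) :=
    fun t => dotProduct_integral_mulVec (hint t)
  refine ⟨fun t => (Ψ t)ᵀ * G t * Ψ t, ⟨?_, S ∪ S', hS.union hS', ?_⟩, ?_, ?_⟩
  · exact (hΦ.cont_inv.matrix_transpose.matrix_mul hGc).matrix_mul hΦ.cont_inv
  · intro t ht
    rw [Set.mem_union, not_or] at ht
    have hGd : HasEntryDerivAt G (-(H t)) t := fun i j => by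
      rw [hGe i j]
      have h := (hHc.entry i j).hasDerivAt_integral 0
        (t := t) ((continuous_id.matrix_elem i j).continuousAt.comp (hd' t ht.2))
      exact (h.const_sub _)
    have hΨd := (hd t ht.1).2
    have h := (hΨd.transpose.mul hGd).mul hΨd
    refine h.congr_deriv ?_
    have e1 : (Ψ t)ᵀ * (Φ t)ᵀ = 1 := by
      rw [← Matrix.transpose_mul, hΦ.mul_inv, Matrix.transpose_one]
    have e2 : (Ψ t)ᵀ * H t * Ψ t = W t := by
      calc (Ψ t)ᵀ * H t * Ψ t = ((Ψ t)ᵀ * (Φ t)ᵀ) * W t * (Φ t * Ψ t) := by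
            simp only [hH, Matrix.mul_assoc]
        _ = W t := by rw [e1, hΦ.mul_inv, Matrix.one_mul, Matrix.mul_one]
    simp only [Matrix.transpose_neg, Matrix.transpose_mul, Matrix.add_mul, Matrix.neg_mul,
      Matrix.mul_neg, Matrix.mul_assoc] at e2 ⊢
    rw [e2]
    abel
  · intro t
    -- The monodromy matrix: translation by `T` multiplies `Φ` by `N` on the right, hence conjugates
    -- `G` by `N`, and the factors `Ψ` undo this.
    set N := Ψ t * Φ (t + T) with hN
    have hΦT : ∀ s, Φ (s + T) = Φ s * N := fun s => by
      rw [hN, ← Matrix.mul_assoc, ← hΦ.transition_periodic hAp s t, Matrix.mul_assoc,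
        hΦ.inv_mul, Matrix.mul_one]
    have hHT : ∀ s, H (s + T) = Nᵀ * H s * N := fun s => by
      simp only [hH, hΦT, hWp s, Matrix.transpose_mul, Matrix.mul_assoc]
    have hGT : G (t + T) = Nᵀ * G t * N := by
      ext i j
      have e3 : ∀ M : Matrix (Fin n) (Fin n) ℝ, (Nᵀ * M * N) i j =
          (N *ᵥ Pi.single i 1) ⬝ᵥ (M *ᵥ (N *ᵥ Pi.single j 1)) := fun M => by
        rw [entry_eq_dotProduct (Nᵀ * M * N) i j, ← Matrix.mulVec_mulVec, ← Matrix.mulVec_mulVec,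
          dotProduct_transpose_mulVec]
      rw [e3, hquad]
      simp only [← e3, ← hHT]
      have h := (measurePreserving_add_right volume T).setIntegral_preimage_emb
        (measurableEmbedding_addRight T) (fun s => H s i j) (Set.Ioi (t + T))
      simp only [Set.preimage_add_const_Ioi, add_sub_cancel_right] at h
      rw [h]
      rfl
    have e4 : N * Ψ (t + T) = Ψ t := by rw [hN, Matrix.mul_assoc, hΦ.mul_inv, Matrix.mul_one]
    dsimp only
    rw [hGT]
    conv_rhs => rw [← e4]
    simp only [Matrix.transpose_mul, Matrix.mul_assoc]
  · intro t
    have hHs : ∀ s, (H s).PosSemidef := fun s => by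
      have := (hW s).conjTranspose_mul_mul_same (Φ s)
      rwa [Matrix.conjTranspose_eq_transpose_of_trivial] at this
    have hGs : (G t).PosSemidef := by
      refine posSemidef_iff_real.mpr ⟨?_, fun v => ?_⟩
      · ext i j
        simp only [hG, Matrix.transpose_apply, Matrix.of_apply]
        refine setIntegral_congr_fun measurableSet_Ioi fun s _ => ?_
        exact congrFun (congrFun (posSemidef_iff_real.mp (hHs s)).1 i) j
      · rw [hquad]
        exact setIntegral_nonneg measurableSet_Ioi fun s _ => (posSemidef_iff_real.mp (hHs s)).2 v
    have := hGs.conjTranspose_mul_mul_same (Ψ t)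
    rwa [Matrix.conjTranspose_eq_transpose_of_trivial] at this

end Existence

/-! ### Observability and positive definiteness -/

section Observability

variable {n m k : ℕ}

/-- Observability is invariant under a scalar shift of the system matrix. -/
theorem Observable.add_smul_one {C : ℝ → Matrix (Fin k) (Fin n) ℝ}
    {A : ℝ → Matrix (Fin n) (Fin n) ℝ} (h : Observable C A) {β : ℝ → ℝ}
    (hβ : PiecewiseContinuous β) :
    Observable C fun t => A t + β t • (1 : Matrix (Fin n) (Fin n) ℝ) := by
  intro t₀ x hx hC
  -- The integrating factor turns a trajectory of the shifted system into one of `A`, and being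
  -- positive it does not affect where the output vanishes.
  set φ : ℝ → ℝ := fun t => Real.exp (-∫ s in (0 : ℝ)..t, β s) with hφ
  have hφc : Continuous φ := (hβ.continuous_integral 0).neg.rexp
  obtain ⟨hxc, S, hS, hd⟩ := hx
  obtain ⟨S', hS', hd'⟩ := hβ.1
  have hy : IsTrajectory A fun t => φ t • x t := by
    refine ⟨hφc.smul hxc, S ∪ S', hS.union hS', fun t ht => ?_⟩
    rw [Set.mem_union, not_or] at ht
    have h1 : HasDerivAt φ (-(φ t * β t)) t := by
      have := (hβ.hasDerivAt_integral 0 (hd' t ht.2)).neg.exp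
      exact this.congr_deriv (by simp [hφ])
    refine (h1.smul (hd t ht.1)).congr_deriv ?_
    rw [Matrix.add_mulVec, Matrix.smul_mulVec, Matrix.one_mulVec, Matrix.mulVec_smul, smul_add,
      smul_smul, neg_smul]
    abel
  have h0 := h t₀ _ hy (by
    filter_upwards [hC] with t ht ht0
    rw [Matrix.mulVec_smul, ht ht0, smul_zero])
  exact (smul_eq_zero.mp h0).resolve_left (Real.exp_pos _).ne'

variable {A : ℝ → Matrix (Fin n) (Fin n) ℝ} {B : ℝ → Matrix (Fin n) (Fin m) ℝ}
  {C : ℝ → Matrix (Fin k) (Fin n) ℝ} {K : ℝ → Matrix (Fin m) (Fin n) ℝ}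
  {R Q : ℝ → Matrix (Fin n) (Fin n) ℝ}

/-- A closed-loop trajectory along which the cost-to-go does not decrease vanishes. -/
theorem IsLyapunov.eq_zero_of_quadratic_le (hobs : Observable C A) {T : ℝ} (hT : 0 < T)
    (hA : PiecewiseContinuous A) (hAp : Function.Periodic A T)
    (hQ : IsLyapunov (fun t => A t + B t * K t)
      (fun t => (C t)ᵀ * C t + (K t)ᵀ * K t + R t) Q)
    (hR : ∀ t, (R t).PosSemidef) {x : ℝ → Fin n → ℝ}
    (hx : IsTrajectory (fun t => A t + B t * K t) x) {t₀ : ℝ}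
    (h : ∀ t, t₀ ≤ t → x t₀ ⬝ᵥ (Q t₀ *ᵥ x t₀) ≤ x t ⬝ᵥ (Q t *ᵥ x t)) : x t₀ = 0 := by
  have hanti := hQ.antitone_quadratic (fun t => ((posSemidef_transpose_mul_self _).add
    (posSemidef_transpose_mul_self _)).add (hR t)) hx
  obtain ⟨S, hS, hd⟩ := hQ.hasDerivAt_quadratic hx
  -- The quadratic form is constant after `t₀`, so its dissipation rate is zero, and each
  -- nonnegative summand of the rate must vanish.
  have hz : ∀ t, t ∉ S → t₀ < t → C t *ᵥ x t = 0 ∧ K t *ᵥ x t = 0 := by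
    intro t ht h0
    have hev : (fun s => x s ⬝ᵥ (Q s *ᵥ x s)) =ᶠ[𝓝 t] fun _ => x t₀ ⬝ᵥ (Q t₀ *ᵥ x t₀) := by
      filter_upwards [lt_mem_nhds h0] with s hs
      exact le_antisymm (hanti hs.le) (h s hs.le)
    have h1 := (hd t ht).unique ((hasDerivAt_const t _).congr_of_eventuallyEq hev)
    rw [neg_eq_zero, Matrix.add_mulVec, Matrix.add_mulVec, dotProduct_add, dotProduct_add,
      dotProduct_gram_mulVec, dotProduct_gram_mulVec] at h1
    have h2 := (posSemidef_iff_real.mp (hR t)).2 (x t)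
    have h3 := dotProduct_self_nonneg_real (C t *ᵥ x t)
    have h4 := dotProduct_self_nonneg_real (K t *ᵥ x t)
    exact ⟨dotProduct_self_eq_zero.mp (by linarith), dotProduct_self_eq_zero.mp (by linarith)⟩
  obtain ⟨Φ, Ψ, hΦ⟩ := exists_isFundamental hA hT hAp
  obtain ⟨hy, hy0⟩ := hΦ.exists_trajectory_through t₀ (x t₀)
  -- Without control action, `x` follows the open loop, but only from `t₀` on. It is therefore
  -- matched there with a full open-loop trajectory, to which observability applies.
  have hconst : ∀ t, t₀ ≤ t → Ψ t *ᵥ x t = Ψ t₀ *ᵥ x t₀ := by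
    intro t ht
    obtain ⟨hxc, S', hS', hd'⟩ := hx
    obtain ⟨S'', hS'', hd''⟩ := hΦ.deriv
    have hder : ∀ u ∈ Set.Ioo t₀ t, u ∉ S ∪ S' ∪ S'' →
        HasDerivAt (fun u => Ψ u *ᵥ x u) 0 u := by
      intro u hu hus
      simp only [Set.mem_union, not_or] at hus
      refine ((hd'' u hus.2).2.mulVec (hd' u hus.1.2)).congr_deriv ?_
      rw [Matrix.add_mulVec, ← Matrix.mulVec_mulVec, (hz u hus.1.1 hu.1).2, Matrix.mulVec_zero,
        Matrix.neg_mulVec, add_zero, Matrix.mulVec_mulVec]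
      simp
    have hc := hΦ.cont_inv.matrix_mulVec hxc
    ext i
    have hci : Continuous fun u => (Ψ u *ᵥ x u) i := (continuous_apply i).comp hc
    refine le_antisymm ?_ ?_
    · exact ((hS.union hS').union hS'').le_of_deriv_nonpos hci ht
        fun u hu hus => ⟨0, le_rfl, hasDerivAt_pi.mp (hder u hu hus) i⟩
    · refine neg_le_neg_iff.mp (((hS.union hS').union hS'').le_of_deriv_nonpos hci.neg ht
        fun u hu hus => ⟨0, le_rfl, ?_⟩)
      simpa using (hasDerivAt_pi.mp (hder u hu hus) i).neg
  have hxy : ∀ t, t₀ ≤ t → (Φ t * Ψ t₀) *ᵥ x t₀ = x t := by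
    intro t ht
    rw [← Matrix.mulVec_mulVec, ← hconst t ht, Matrix.mulVec_mulVec, hΦ.mul_inv, Matrix.one_mulVec]
  have h0 := hobs t₀ _ hy (by
    filter_upwards [hS.ae_notMem, Measure.ae_ne volume t₀] with t ht hne ht0
    rw [hxy t ht0]
    exact (hz t ht (lt_of_le_of_ne ht0 (Ne.symm hne))).1)
  rwa [hy0] at h0

/-- A null vector of `Q t` starts a trajectory whose cost-to-go is already minimal, so it cannot
decrease, and observability forces the vector to be zero. -/
theorem IsLyapunov.posDef (hobs : Observable C A) {T : ℝ} (hT : 0 < T)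
    (hA : PiecewiseContinuous A) (hAp : Function.Periodic A T)
    (hK : PiecewiseContinuous fun t => A t + B t * K t)
    (hKp : Function.Periodic (fun t => A t + B t * K t) T)
    (hQ : IsLyapunov (fun t => A t + B t * K t)
      (fun t => (C t)ᵀ * C t + (K t)ᵀ * K t + R t) Q)
    (hR : ∀ t, (R t).PosSemidef) (hQs : ∀ t, (Q t).PosSemidef) (t : ℝ) : (Q t).PosDef := by
  refine posDef_iff_real.mpr ⟨(posSemidef_iff_real.mp (hQs t)).1, fun v hv => ?_⟩
  refine lt_of_le_of_ne ((posSemidef_iff_real.mp (hQs t)).2 v) fun h0 => hv ?_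
  obtain ⟨Φ, Ψ, hΦ⟩ := exists_isFundamental hK hT hKp
  obtain ⟨hx, hx0⟩ := hΦ.exists_trajectory_through t v
  have := hQ.eq_zero_of_quadratic_le hobs hT hA hAp hR hx (t₀ := t) (fun s _ => by
    rw [hx0, ← h0]
    exact (posSemidef_iff_real.mp (hQs s)).2 _)
  rwa [hx0] at this

end Observability

/-! ### Exponential stability from Lyapunov functions; the adjoint system -/

section Stability

variable {n m k : ℕ}

theorem le_quadratic_of_sphere {M : Matrix (Fin n) (Fin n) ℝ} {c : ℝ}
    (h : ∀ v ∈ Metric.sphere (0 : Fin n → ℝ) 1, c ≤ v ⬝ᵥ (M *ᵥ v)) (v : Fin n → ℝ) :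
    c * ‖v‖ ^ 2 ≤ v ⬝ᵥ (M *ᵥ v) := by
  rcases eq_or_ne v 0 with rfl | hv
  · simp
  · have hv' : ‖v‖ ≠ 0 := norm_ne_zero_iff.mpr hv
    have h1 := h (‖v‖⁻¹ • v) (by simp [norm_smul, hv'])
    rw [Matrix.mulVec_smul, smul_dotProduct, dotProduct_smul, smul_eq_mul, smul_eq_mul] at h1
    calc c * ‖v‖ ^ 2 ≤ (‖v‖⁻¹ * (‖v‖⁻¹ * (v ⬝ᵥ (M *ᵥ v)))) * ‖v‖ ^ 2 := by gcongr
      _ = v ⬝ᵥ (M *ᵥ v) := by field_simp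

theorem exists_quadratic_lower_bound {Q : ℝ → Matrix (Fin n) (Fin n) ℝ} (hQ : Continuous Q)
    {T : ℝ} (hT : 0 < T) (hp : Function.Periodic Q T) (hpd : ∀ t, (Q t).PosDef) :
    ∃ c, 0 < c ∧ ∀ t (v : Fin n → ℝ), c * ‖v‖ ^ 2 ≤ v ⬝ᵥ (Q t *ᵥ v) := by
  have hf : Continuous fun p : ℝ × (Fin n → ℝ) => p.2 ⬝ᵥ (Q p.1 *ᵥ p.2) :=
    continuous_snd.dotProduct ((hQ.comp continuous_fst).matrix_mulVec continuous_snd)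
  obtain ⟨c, hc, h⟩ := ((isCompact_Icc (a := (0 : ℝ)) (b := T)).prod
    (isCompact_sphere (0 : Fin n → ℝ) 1)).exists_forall_le' hf.continuousOn (a := 0) (by
      rintro ⟨t, v⟩ ⟨-, hv⟩
      refine (posDef_iff_real.mp (hpd t)).2 v fun h0 => ?_
      simp [h0] at hv)
  refine ⟨c, hc, fun t => le_quadratic_of_sphere fun v hv => ?_⟩
  obtain ⟨s, hs, hst⟩ := hp.exists_mem_Ico₀ hT t
  rw [hst]
  exact h (s, v) ⟨⟨hs.1, hs.2.le⟩, hv⟩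

/-- A quadratic Lyapunov function that contracts by a fixed factor over a fixed time yields
exponential stability. -/
theorem exponentiallyStable_of_contraction {A Q : ℝ → Matrix (Fin n) (Fin n) ℝ} {c C ρ L : ℝ}
    (hc : 0 < c) (hC : 0 ≤ C) (hL : 0 < L) (hρ : 0 < ρ) (hρ1 : ρ < 1)
    (hlow : ∀ t (v : Fin n → ℝ), c * ‖v‖ ^ 2 ≤ v ⬝ᵥ (Q t *ᵥ v))
    (hup : ∀ t (v : Fin n → ℝ), v ⬝ᵥ (Q t *ᵥ v) ≤ C * ‖v‖ ^ 2)
    (hanti : ∀ x, IsTrajectory A x → Antitone fun t => x t ⬝ᵥ (Q t *ᵥ x t))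
    (hcon : ∀ x, IsTrajectory A x → ∀ s,
      x (s + L) ⬝ᵥ (Q (s + L) *ᵥ x (s + L)) ≤ ρ * (x s ⬝ᵥ (Q s *ᵥ x s))) :
    ExponentiallyStable A := by
  have hlog : Real.log ρ < 0 := Real.log_neg hρ hρ1
  -- The square root and the halved rate pass from the quadratic form to the norm. The factor `exp
  -- (-log ρ) = 1/ρ` pays for the incomplete last block of length `L`.
  refine ⟨√(C / c * Real.exp (-Real.log ρ)), -Real.log ρ / L / 2, by
    have : 0 < -Real.log ρ := by linarith
    positivity, fun x hx s t hst => ?_⟩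
  set V : ℝ → ℝ := fun t => x t ⬝ᵥ (Q t *ᵥ x t) with hV
  have hV0 : ∀ t, 0 ≤ V t := fun t => le_trans (by positivity) (hlow t (x t))
  have hiter : ∀ j : ℕ, V (s + j * L) ≤ ρ ^ j * V s := by
    intro j
    induction j with
    | zero => simp
    | succ j ih =>
      have h1 := hcon x hx (s + j * L)
      have e : s + ((j + 1 : ℕ) : ℝ) * L = s + j * L + L := by push_cast; ring
      rw [e, pow_succ']
      calc V (s + j * L + L) ≤ ρ * V (s + j * L) := h1
        _ ≤ ρ * (ρ ^ j * V s) := by gcongr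
        _ = _ := by ring
  set j := ⌊(t - s) / L⌋₊ with hj
  have hts : 0 ≤ (t - s) / L := div_nonneg (by linarith) hL.le
  have hj1 : (j : ℝ) ≤ (t - s) / L := Nat.floor_le hts
  have hj2 : (t - s) / L < j + 1 := Nat.lt_floor_add_one _
  have hj3 : s + j * L ≤ t := by
    rw [le_div_iff₀ hL] at hj1
    linarith
  have hpow : ρ ^ j ≤ Real.exp (-Real.log ρ) * Real.exp (-(-Real.log ρ / L) * (t - s)) := by
    rw [← Real.rpow_natCast, Real.rpow_def_of_pos hρ, ← Real.exp_add]
    apply Real.exp_le_exp.mpr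
    have e : -(-Real.log ρ / L) * (t - s) = Real.log ρ * ((t - s) / L) := by ring
    rw [e]
    nlinarith
  have hmain : c * ‖x t‖ ^ 2 ≤ (Real.exp (-Real.log ρ) *
      Real.exp (-(-Real.log ρ / L) * (t - s))) * (C * ‖x s‖ ^ 2) :=
    calc c * ‖x t‖ ^ 2 ≤ V t := hlow t (x t)
      _ ≤ V (s + j * L) := hanti x hx hj3
      _ ≤ ρ ^ j * V s := hiter j
      _ ≤ _ := mul_le_mul hpow (hup s (x s)) (hV0 s) (by positivity)
  refine le_of_sq_le_sq ?_ (by positivity)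
  have e : Real.exp (-(-Real.log ρ / L / 2) * (t - s)) ^ 2
      = Real.exp (-(-Real.log ρ / L) * (t - s)) := by
    rw [← Real.exp_nat_mul]
    congr 1
    push_cast
    ring
  rw [mul_pow, mul_pow, e, Real.sq_sqrt (by positivity)]
  calc ‖x t‖ ^ 2 = (c * ‖x t‖ ^ 2) / c := by field_simp
    _ ≤ _ := div_le_div_of_nonneg_right hmain hc.le
    _ = _ := by ring

variable {A : ℝ → Matrix (Fin n) (Fin n) ℝ} {B : ℝ → Matrix (Fin n) (Fin m) ℝ}
  {C : ℝ → Matrix (Fin k) (Fin n) ℝ} {K : ℝ → Matrix (Fin m) (Fin n) ℝ}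
  {R Q : ℝ → Matrix (Fin n) (Fin n) ℝ}

/-- Lyapunov's stability theorem for an observable cost. -/
theorem IsLyapunov.exponentiallyStable (hobs : Observable C A) {T : ℝ} (hT : 0 < T)
    (hA : PiecewiseContinuous A) (hAp : Function.Periodic A T)
    (hK : PiecewiseContinuous fun t => A t + B t * K t)
    (hKp : Function.Periodic (fun t => A t + B t * K t) T)
    (hQ : IsLyapunov (fun t => A t + B t * K t)
      (fun t => (C t)ᵀ * C t + (K t)ᵀ * K t + R t) Q)
    (hR : ∀ t, (R t).PosSemidef) (hQp : Function.Periodic Q T) (hpd : ∀ t, (Q t).PosDef) :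
    ExponentiallyStable fun t => A t + B t * K t := by
  obtain ⟨Φ, Ψ, hΦ⟩ := exists_isFundamental hK hT hKp
  have hanti := fun x hx => hQ.antitone_quadratic (fun t => ((posSemidef_transpose_mul_self _).add
    (posSemidef_transpose_mul_self _)).add (hR t)) (x := x) hx
  obtain ⟨c, hc, hlow⟩ := exists_quadratic_lower_bound hQ.1 hT hQp hpd
  obtain ⟨r, hr0, hr⟩ := hQ.exists_entry_bound hT hQp
  set U : ℕ → Matrix (Fin n) (Fin n) ℝ := fun j => Φ (j * T) * Ψ 0 with hU
  have hUx : ∀ (v : Fin n → ℝ) (j : ℕ), v ⬝ᵥ ((Q 0 - (U j)ᵀ * Q (j * T) * U j) *ᵥ v) =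
      v ⬝ᵥ (Q 0 *ᵥ v) - (U j *ᵥ v) ⬝ᵥ (Q (j * T) *ᵥ (U j *ᵥ v)) := fun v j => by
    rw [Matrix.sub_mulVec, dotProduct_sub, ← Matrix.mulVec_mulVec, ← Matrix.mulVec_mulVec,
      dotProduct_transpose_mulVec]
  -- The sets of unit vectors whose cost has strictly dropped after `j` periods are open and
  -- increase with `j`; by observability they cover the sphere. By compactness a single `N` works
  -- for all.
  have hcover : ∃ N : ℕ, Metric.sphere (0 : Fin n → ℝ) 1 ⊆
      {v | 0 < v ⬝ᵥ ((Q 0 - (U N)ᵀ * Q (N * T) * U N) *ᵥ v)} := by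
    refine (isCompact_sphere (0 : Fin n → ℝ) 1).elim_directed_cover _ (fun j => ?_) ?_ ?_
    · exact isOpen_lt continuous_const
        (continuous_id.dotProduct (continuous_const.matrix_mulVec continuous_id))
    · intro v hv
      have hv0 : v ≠ 0 := fun h0 => by simp [h0] at hv
      obtain ⟨hx, hx0⟩ := hΦ.exists_trajectory_through 0 v
      by_contra hcon
      simp only [Set.mem_iUnion, Set.mem_ofPred_eq, not_exists, not_lt, hUx] at hcon
      refine hv0 (hx0 ▸ hQ.eq_zero_of_quadratic_le hobs hT hA hAp hR hx (t₀ := 0) fun t _ => ?_)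
      obtain ⟨j, hj⟩ := exists_nat_ge (t / T)
      rw [div_le_iff₀ hT] at hj
      refine le_trans ?_ (hanti _ hx hj)
      have := hcon j
      rw [hx0]
      linarith
    · refine (directed_of_isDirected_le fun i j hij => ?_)
      intro v hv
      simp only [Set.mem_ofPred_eq, hUx] at hv ⊢
      have h1 := hanti _ (hΦ.exists_trajectory_through 0 v).1
        (show (i : ℝ) * T ≤ j * T by gcongr)
      dsimp only at h1
      linarith
  obtain ⟨N, hN⟩ := hcover
  obtain ⟨δ, hδ, hδN⟩ := (isCompact_sphere (0 : Fin n → ℝ) 1).exists_forall_le'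
    (continuous_id.dotProduct (continuous_const.matrix_mulVec continuous_id)).continuousOn
    (a := 0) hN
  have hup : ∀ t (v : Fin n → ℝ), v ⬝ᵥ (Q t *ᵥ v) ≤ (n * n * r) * ‖v‖ ^ 2 := fun t v =>
    (le_abs_self _).trans (abs_quadratic_le hr0 (hr t) v)
  set D : ℝ := n * n * r with hD
  have hD0 : 0 ≤ D := by positivity
  -- The drop is at least `δ ‖x‖²` and the form is at most `D ‖x‖²`; the extra `δ + 1` puts `ρ`
  -- strictly between `0` and `1` even when `D = 0`.
  set ρ : ℝ := 1 - δ / (D + δ + 1) with hρdef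
  have hρ : 0 < ρ := by
    rw [hρdef, sub_pos, div_lt_one (by positivity)]
    linarith
  have hρ1 : ρ < 1 := by
    rw [hρdef]
    have : 0 < δ / (D + δ + 1) := by positivity
    linarith
  have hstep : ∀ y, IsTrajectory (fun t => A t + B t * K t) y →
      y (N * T) ⬝ᵥ (Q (N * T) *ᵥ y (N * T)) ≤ ρ * (y 0 ⬝ᵥ (Q 0 *ᵥ y 0)) := by
    intro y hy
    have h1 : U N *ᵥ y 0 = y (N * T) := (hΦ.trajectory_eq hy 0 (N * T)).symm
    have h2 := le_quadratic_of_sphere (M := Q 0 - (U N)ᵀ * Q (N * T) * U N) hδN (y 0)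
    rw [hUx, h1] at h2
    have h3 := hup 0 (y 0)
    have h4 : δ / (D + δ + 1) * (y 0 ⬝ᵥ (Q 0 *ᵥ y 0)) ≤ δ * ‖y 0‖ ^ 2 := by
      rw [div_mul_eq_mul_div, div_le_iff₀ (by positivity), mul_assoc]
      refine mul_le_mul_of_nonneg_left (h3.trans ?_) hδ.le
      nlinarith [sq_nonneg ‖y 0‖]
    rw [hρdef]
    linarith
  -- One period more than `N`: from an arbitrary time it takes up to `T` to reach the next multiple
  -- of `T`, where the contraction over `N` periods applies.
  refine exponentiallyStable_of_contraction hc hD0 (L := (N + 1) * T) (by positivity) hρ hρ1 hlow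
    hup hanti fun x hx s => ?_
  set j := ⌈s / T⌉ with hj
  have hj1 : s ≤ j * T := by
    rw [← div_le_iff₀ hT]
    exact Int.le_ceil _
  have hj2 : (j : ℝ) * T ≤ s + T := by
    have := (Int.ceil_lt_add_one (s / T)).le
    rw [← hj] at this
    calc (j : ℝ) * T ≤ (s / T + 1) * T := by gcongr
      _ = s + T := by field_simp
  have hQj := hQp.int_mul j
  have h1 := hstep _ (hx.translate (hKp.int_mul j))
  rw [← hQj (N * T), ← hQj 0, zero_add] at h1
  refine (hanti x hx (show (N : ℝ) * T + j * T ≤ s + (N + 1) * T by linarith)).trans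
    (h1.trans ?_)
  gcongr
  exact hanti x hx hj1

theorem norm_single_one (i : Fin n) : ‖(Pi.single i 1 : Fin n → ℝ)‖ = 1 :=
  (Pi.norm_single (G := fun _ : Fin n => ℝ) (1 : ℝ)).trans norm_one

/-- The time-reversed adjoint system of an exponentially stable system is stable. -/
theorem ExponentiallyStable.adjoint {A : ℝ → Matrix (Fin n) (Fin n) ℝ}
    (hst : ExponentiallyStable A) {T : ℝ} (hT : 0 < T)
    (hA : PiecewiseContinuous A) (hAp : Function.Periodic A T) :
    ExponentiallyStable fun t => (A (-t))ᵀ := by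
  obtain ⟨Φ, Ψ, hΦ⟩ := exists_isFundamental hA hT hAp
  obtain ⟨M, lam, hlam, h⟩ := hst
  -- The definition of stability leaves the sign of `M` open; a unit initial vector at equal times
  -- forces `1 ≤ M`. In dimension zero there is no such vector, hence the case split below.
  have hM : ∀ i : Fin n, 0 ≤ M := fun i => by
    obtain ⟨hx, hx0⟩ := hΦ.exists_trajectory_through 0 (Pi.single i 1)
    have h1 := h _ hx 0 0 le_rfl
    rw [hx0] at h1
    rw [norm_single_one] at h1
    simp at h1
    linarith
  refine ⟨n * M, lam, hlam, fun z hz s t hst => ?_⟩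
  obtain ⟨hzc, S, hS, hd⟩ := hz
  have key : ∀ i, |z t i| ≤ n * M * Real.exp (-lam * (t - s)) * ‖z s‖ := by
    intro i
    obtain ⟨hx, hx0⟩ := hΦ.exists_trajectory_through (-t) (Pi.single i 1)
    set x := fun u => (Φ u * Ψ (-t)) *ᵥ (Pi.single i 1 : Fin n → ℝ)
    obtain ⟨hxc, S', hS', hd'⟩ := hx
    -- The pairing of an adjoint trajectory with a time-reversed one is constant. With the latter
    -- starting at a basis vector, it reads off one coordinate of `z t`.
    have hconst := (hS.union hS'.neg).eq_of_deriv_zero (g := fun u => z u ⬝ᵥ x (-u))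
      (hzc.dotProduct (hxc.comp continuous_neg)) (fun u hu => by
        rw [Set.mem_union, not_or] at hu
        have h1 : HasDerivAt (fun u => x (-u)) (-(A (-u) *ᵥ x (-u))) u := by
          have := (hd' (-u) hu.2).scomp u (hasDerivAt_neg u)
          exact this.congr_deriv (by simp)
        refine (hasDerivAt_dotProduct (hd u hu.1) h1).congr_deriv ?_
        rw [dotProduct_comm, dotProduct_transpose_mulVec, dotProduct_neg,
          dotProduct_comm (z u)]
        ring) t s
    have h1 : z t ⬝ᵥ x (-t) = z t i := by
      simp only [x, hx0]
      simp
    have h2 := h x ⟨hxc, S', hS', hd'⟩ (-t) (-s) (by linarith)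
    have h3 : ‖x (-t)‖ = 1 := by
      simp only [x, hx0]
      exact norm_single_one i
    rw [h3, mul_one] at h2
    have e : -s - -t = t - s := by ring
    rw [e] at h2
    rw [← h1]
    rw [hconst]
    calc |z s ⬝ᵥ x (-s)| ≤ n * (‖z s‖ * ‖x (-s)‖) := abs_dotProduct_le _ _
      _ ≤ n * (‖z s‖ * (M * Real.exp (-lam * (t - s)))) := by gcongr
      _ = _ := by ring
  rcases isEmpty_or_nonempty (Fin n) with hn | ⟨⟨i⟩⟩
  · have : z t = 0 := Subsingleton.elim _ _
    have h' : z s = 0 := Subsingleton.elim _ _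
    simp [this, h']
  · have := hM i
    rw [pi_norm_le_iff_of_nonneg (by positivity)]
    exact key

end Stability

/-! ### Riccati equation: uniqueness, and existence by policy iteration -/

section Riccati

variable {n m k : ℕ}

/-- A piecewise continuous periodic system with observable output. -/
structure IsObservableSystem (T : ℝ) (A : ℝ → Matrix (Fin n) (Fin n) ℝ)
    (B : ℝ → Matrix (Fin n) (Fin m) ℝ) (C : ℝ → Matrix (Fin k) (Fin n) ℝ) : Prop where
  period_pos : 0 < T
  pc_A : PiecewiseContinuous A
  pc_B : PiecewiseContinuous B
  pc_C : PiecewiseContinuous C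
  periodic_A : Function.Periodic A T
  periodic_B : Function.Periodic B T
  periodic_C : Function.Periodic C T
  observable : Observable C A

/-- `Q` solves the Riccati equation `-Q' = Q A + Aᵀ Q + Cᵀ C - Q B Bᵀ Q`. -/
abbrev IsRiccati (A : ℝ → Matrix (Fin n) (Fin n) ℝ) (B : ℝ → Matrix (Fin n) (Fin m) ℝ)
    (C : ℝ → Matrix (Fin k) (Fin n) ℝ) (Q : ℝ → Matrix (Fin n) (Fin n) ℝ) : Prop :=
  IsMatrixSolution (fun t X => -(X * A t + (A t)ᵀ * X + (C t)ᵀ * C t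
    - X * B t * (B t)ᵀ * X)) Q

variable {T : ℝ} {A : ℝ → Matrix (Fin n) (Fin n) ℝ} {B : ℝ → Matrix (Fin n) (Fin m) ℝ}
  {C : ℝ → Matrix (Fin k) (Fin n) ℝ} {K : ℝ → Matrix (Fin m) (Fin n) ℝ}
  {Q : ℝ → Matrix (Fin n) (Fin n) ℝ}

theorem IsObservableSystem.pc_loop (h : IsObservableSystem T A B C) (hK : IsGain T K) :
    PiecewiseContinuous fun t => A t + B t * K t :=
  h.pc_A.add (h.pc_B.matrix_mul hK.1)

theorem IsObservableSystem.periodic_loop (h : IsObservableSystem T A B C) (hK : IsGain T K) :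
    Function.Periodic (fun t => A t + B t * K t) T := fun t => by
  simp only [h.periodic_A t, h.periodic_B t, hK.2 t]

theorem IsObservableSystem.isGain (h : IsObservableSystem T A B C) (hQ : Continuous Q)
    (hQp : Function.Periodic Q T) : IsGain T fun t => -((B t)ᵀ * Q t) :=
  ⟨(h.pc_B.matrix_transpose.matrix_mul hQ.piecewiseContinuous).neg, fun t => by
    simp only [h.periodic_B t, hQp t]⟩

theorem completion_of_squares (A X : Matrix (Fin n) (Fin n) ℝ) (B : Matrix (Fin n) (Fin m) ℝ)
    (K : Matrix (Fin m) (Fin n) ℝ) (hX : Xᵀ = X) :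
    X * (A + B * K) + (A + B * K)ᵀ * X + Kᵀ * K - (K + Bᵀ * X)ᵀ * (K + Bᵀ * X) =
      X * A + Aᵀ * X - X * B * Bᵀ * X := by
  simp only [Matrix.transpose_add, Matrix.transpose_mul, Matrix.transpose_transpose, hX,
    Matrix.mul_add, Matrix.add_mul, Matrix.mul_assoc]
  abel

theorem IsRiccati.isLyapunov (hQ : IsRiccati A B C Q) (hs : ∀ t, (Q t)ᵀ = Q t)
    (K : ℝ → Matrix (Fin m) (Fin n) ℝ) :
    IsLyapunov (fun t => A t + B t * K t) (fun t => (C t)ᵀ * C t + (K t)ᵀ * K t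
      - (K t + (B t)ᵀ * Q t)ᵀ * (K t + (B t)ᵀ * Q t)) Q := by
  obtain ⟨hc, S, hS, hd⟩ := hQ
  refine ⟨hc, S, hS, fun t ht => ?_⟩
  refine HasEntryDerivAt.congr_deriv (X := Q) (hd t ht) ?_
  have h := completion_of_squares (A t) (Q t) (B t) (K t) (hs t)
  dsimp only
  rw [neg_inj, add_sub_right_comm (_ + _), ← h]
  abel

theorem IsRiccati.isLyapunov_self (hQ : IsRiccati A B C Q) (hs : ∀ t, (Q t)ᵀ = Q t) :
    IsLyapunov (fun t => A t + B t * -((B t)ᵀ * Q t)) (fun t => (C t)ᵀ * C t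
      + (-((B t)ᵀ * Q t))ᵀ * -((B t)ᵀ * Q t) + 0) Q := by
  refine (hQ.isLyapunov hs fun t => -((B t)ᵀ * Q t)).congr fun t => ?_
  simp

theorem IsRiccati.posDef (h : IsObservableSystem T A B C) (hQ : IsRiccati A B C Q)
    (hQp : Function.Periodic Q T) (hQs : ∀ t, (Q t).PosSemidef) (t : ℝ) : (Q t).PosDef :=
  (hQ.isLyapunov_self fun t => (posSemidef_iff_real.mp (hQs t)).1).posDef h.observable
    h.period_pos h.pc_A h.periodic_A (h.pc_loop (h.isGain hQ.1 hQp))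
    (h.periodic_loop (h.isGain hQ.1 hQp)) (fun _ => Matrix.PosSemidef.zero) hQs t

theorem IsRiccati.exponentiallyStable (h : IsObservableSystem T A B C) (hQ : IsRiccati A B C Q)
    (hQp : Function.Periodic Q T) (hpd : ∀ t, (Q t).PosDef) :
    ExponentiallyStable fun t => A t + B t * -((B t)ᵀ * Q t) :=
  (hQ.isLyapunov_self fun t => (posDef_iff_real.mp (hpd t)).1).exponentiallyStable h.observable
    h.period_pos h.pc_A h.periodic_A (h.pc_loop (h.isGain hQ.1 hQp))
    (h.periodic_loop (h.isGain hQ.1 hQp)) (fun _ => Matrix.PosSemidef.zero) hQp hpd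

/-- Under the stabilizing gain of `Q`, both matrices solve Lyapunov equations, and the inhomogeneity
for `Q'` is smaller by a Gram matrix. -/
theorem IsRiccati.quadratic_le {Q' : ℝ → Matrix (Fin n) (Fin n) ℝ}
    (h : IsObservableSystem T A B C) (hQ : IsRiccati A B C Q)
    (hQ' : IsRiccati A B C Q') (hQp : Function.Periodic Q T) (hQp' : Function.Periodic Q' T)
    (hpd : ∀ t, (Q t).PosDef) (hpd' : ∀ t, (Q' t).PosDef) (t : ℝ) (v : Fin n → ℝ) :
    v ⬝ᵥ (Q' t *ᵥ v) ≤ v ⬝ᵥ (Q t *ᵥ v) := by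
  have hs := fun t => (posDef_iff_real.mp (hpd t)).1
  have hs' := fun t => (posDef_iff_real.mp (hpd' t)).1
  refine (hQ.isLyapunov_self hs).quadratic_le (hQ'.isLyapunov hs' fun t => -((B t)ᵀ * Q t))
    h.period_pos (h.pc_loop (h.isGain hQ.1 hQp)) (h.periodic_loop (h.isGain hQ.1 hQp))
    (hQ.exponentiallyStable h hQp hpd) hQp hQp' (fun t => ?_) t v
  rw [add_zero, sub_sub_cancel]
  exact posSemidef_transpose_mul_self _

theorem IsRiccati.unique {Q' : ℝ → Matrix (Fin n) (Fin n) ℝ}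
    (h : IsObservableSystem T A B C) (hQ : IsRiccati A B C Q)
    (hQ' : IsRiccati A B C Q') (hQp : Function.Periodic Q T) (hQp' : Function.Periodic Q' T)
    (hpd : ∀ t, (Q t).PosDef) (hpd' : ∀ t, (Q' t).PosDef) : Q = Q' := by
  funext t
  exact eq_of_quadratic_eq (posDef_iff_real.mp (hpd t)).1 (posDef_iff_real.mp (hpd' t)).1
    fun v => le_antisymm (hQ'.quadratic_le h hQ hQp' hQp hpd' hpd t v)
      (hQ.quadratic_le h hQ' hQp hQp' hpd hpd' t v)

/-- Policy improvement: the equation for the cost of `K` in terms of the improved gain. -/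
theorem IsLyapunov.improve (hs : ∀ t, (Q t)ᵀ = Q t)
    (hQ : IsLyapunov (fun t => A t + B t * K t) (fun t => (C t)ᵀ * C t + (K t)ᵀ * K t) Q) :
    IsLyapunov (fun t => A t + B t * -((B t)ᵀ * Q t)) (fun t => (C t)ᵀ * C t
      + (-((B t)ᵀ * Q t))ᵀ * -((B t)ᵀ * Q t)
      + (K t + (B t)ᵀ * Q t)ᵀ * (K t + (B t)ᵀ * Q t)) Q := by
  refine hQ.congr fun t => ?_
  have h1 := completion_of_squares (A t) (Q t) (B t) (K t) (hs t)
  have h2 := completion_of_squares (A t) (Q t) (B t) (-((B t)ᵀ * Q t)) (hs t)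
  rw [← h1] at h2
  simp only [neg_add_cancel, Matrix.mul_zero, sub_zero] at h2
  calc _ = (C t)ᵀ * C t + (Q t * (A t + B t * K t) + (A t + B t * K t)ᵀ * Q t
          + (K t)ᵀ * K t) := by abel
    _ = _ := by
      rw [sub_eq_iff_eq_add.mp h2.symm]
      abel

/-- Kleinman's policy iteration. -/
theorem exists_policy_iteration (h : IsObservableSystem T A B C) (hK : IsGain T K)
    (hst : ExponentiallyStable fun t => A t + B t * K t) :
    ∃ Q : ℕ → ℝ → Matrix (Fin n) (Fin n) ℝ,
      (∀ i, Continuous (Q i)) ∧ (∀ i, Function.Periodic (Q i) T) ∧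
      (∀ i t, (Q i t).PosSemidef) ∧
      (∀ i, IsLyapunov (fun t => A t + B t * -((B t)ᵀ * Q i t))
        (fun t => (C t)ᵀ * C t + (-((B t)ᵀ * Q i t))ᵀ * -((B t)ᵀ * Q i t)) (Q (i + 1))) ∧
      ∀ t v, Antitone fun i => v ⬝ᵥ (Q i t *ᵥ v) := by
  have hsol : ∀ K : {K : ℝ → Matrix (Fin m) (Fin n) ℝ //
      IsGain T K ∧ ExponentiallyStable fun t => A t + B t * K t},
      ∃ Q, IsLyapunov (fun t => A t + B t * K.1 t)
        (fun t => (C t)ᵀ * C t + (K.1 t)ᵀ * K.1 t) Q ∧ Function.Periodic Q T ∧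
          ∀ t, (Q t).PosSemidef := fun K => by
    refine exists_isLyapunov h.period_pos (h.pc_loop K.2.1) (h.periodic_loop K.2.1) K.2.2
      ((h.pc_C.matrix_transpose.matrix_mul h.pc_C).add
        (K.2.1.1.matrix_transpose.matrix_mul K.2.1.1)) (fun t => ?_)
      fun t => (posSemidef_transpose_mul_self _).add (posSemidef_transpose_mul_self _)
    simp only [h.periodic_C t, K.2.1.2 t]
  choose cost hcost hcostp hcosts using hsol
  have himp := fun K => (hcost K).improve fun t => (posSemidef_iff_real.mp (hcosts K t)).1
  have hnext : ∀ K, IsGain T (fun t => -((B t)ᵀ * cost K t)) ∧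
      ExponentiallyStable fun t => A t + B t * -((B t)ᵀ * cost K t) := fun K => by
    have hg := h.isGain (hcost K).1 (hcostp K)
    have hpd : ∀ t, (cost K t).PosDef := IsLyapunov.posDef (R := fun _ => 0) h.observable
      h.period_pos h.pc_A h.periodic_A (h.pc_loop K.2.1) (h.periodic_loop K.2.1)
      ((hcost K).congr fun t => by simp) (fun _ => Matrix.PosSemidef.zero) (hcosts K)
    exact ⟨hg, (himp K).exponentiallyStable h.observable h.period_pos h.pc_A h.periodic_A
      (h.pc_loop hg) (h.periodic_loop hg) (fun t => posSemidef_transpose_mul_self _)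
      (hcostp K) hpd⟩
  -- Iterating in the subtype of stabilizing gains carries along the stability needed to define the
  -- next cost.
  let gain : ℕ → {K : ℝ → Matrix (Fin m) (Fin n) ℝ //
      IsGain T K ∧ ExponentiallyStable fun t => A t + B t * K t} := fun i =>
    Nat.rec ⟨K, hK, hst⟩ (fun _ K => ⟨_, hnext K⟩) i
  have hstep : ∀ i, IsLyapunov (fun t => A t + B t * -((B t)ᵀ * cost (gain i) t))
      (fun t => (C t)ᵀ * C t + (-((B t)ᵀ * cost (gain i) t))ᵀ * -((B t)ᵀ * cost (gain i) t))
      (cost (gain (i + 1))) := fun i => hcost (gain (i + 1))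
  refine ⟨fun i => cost (gain i), fun i => (hcost _).1, fun i => hcostp _, fun i => hcosts _,
    hstep, fun t v => antitone_nat_of_succ_le fun i => ?_⟩
  have hg := (hnext (gain i)).1
  refine (himp (gain i)).quadratic_le (hstep i) h.period_pos (h.pc_loop hg) (h.periodic_loop hg)
    (hnext (gain i)).2 (hcostp _) (hcostp _) (fun t => ?_) t v
  rw [add_sub_cancel_left]
  exact posSemidef_transpose_mul_self _

/-- Transfers convergence and bounds from the quadratic forms, where monotonicity lives, to matrix
entries. -/
theorem entry_polarization {M : Matrix (Fin n) (Fin n) ℝ} (hM : Mᵀ = M) (i j : Fin n) :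
    M i j = ((Pi.single i 1 + Pi.single j 1 : Fin n → ℝ) ⬝ᵥ
        (M *ᵥ (Pi.single i 1 + Pi.single j 1 : Fin n → ℝ))
      - (Pi.single i 1 : Fin n → ℝ) ⬝ᵥ (M *ᵥ Pi.single i 1)
      - (Pi.single j 1 : Fin n → ℝ) ⬝ᵥ (M *ᵥ Pi.single j 1)) / 2 := by
  have h1 : M j i = M i j := congrFun (congrFun hM i) j
  simp only [Matrix.mulVec_add, dotProduct_add, add_dotProduct, ← entry_eq_dotProduct, h1]
  ring

theorem isCompact_entry_bound (a b : ℕ) (c : ℝ) :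
    IsCompact {M : Matrix (Fin a) (Fin b) ℝ | ∀ i j, |M i j| ≤ c} := by
  have h : IsCompact (Set.univ.pi fun _ : Fin a => Set.univ.pi fun _ : Fin b => Set.Icc (-c) c) :=
    isCompact_univ_pi fun _ => isCompact_univ_pi fun _ => isCompact_Icc
  have e : {M : Fin a → Fin b → ℝ | ∀ i j, |M i j| ≤ c} =
      Set.univ.pi fun _ : Fin a => Set.univ.pi fun _ : Fin b => Set.Icc (-c) c := by
    ext M
    simp only [Set.mem_ofPred_eq, Set.mem_pi, Set.mem_univ, true_imp_iff, Set.mem_Icc, abs_le]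
  exact e ▸ h

/-- The right-hand side of the Lyapunov equation for `X` under the gain `-Bᵀ Y`, as a function of
`(A, B, C, X, Y)`. -/
def lyapunovRhs (p : Matrix (Fin n) (Fin n) ℝ × Matrix (Fin n) (Fin m) ℝ ×
    Matrix (Fin k) (Fin n) ℝ × Matrix (Fin n) (Fin n) ℝ × Matrix (Fin n) (Fin n) ℝ) :
    Matrix (Fin n) (Fin n) ℝ :=
  -(p.2.2.2.1 * (p.1 + p.2.1 * -(p.2.1ᵀ * p.2.2.2.2))
    + (p.1 + p.2.1 * -(p.2.1ᵀ * p.2.2.2.2))ᵀ * p.2.2.2.1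
    + (p.2.2.1ᵀ * p.2.2.1 + (-(p.2.1ᵀ * p.2.2.2.2))ᵀ * -(p.2.1ᵀ * p.2.2.2.2)))

theorem continuous_lyapunovRhs : Continuous (lyapunovRhs (n := n) (m := m) (k := k)) := by
  unfold lyapunovRhs
  fun_prop

theorem lyapunovRhs_self (A : Matrix (Fin n) (Fin n) ℝ) (B : Matrix (Fin n) (Fin m) ℝ)
    (C : Matrix (Fin k) (Fin n) ℝ) {X : Matrix (Fin n) (Fin n) ℝ} (hX : Xᵀ = X) :
    lyapunovRhs (A, B, C, X, X) = -(X * A + Aᵀ * X + Cᵀ * C - X * B * Bᵀ * X) := by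
  have h := completion_of_squares A X B (-(Bᵀ * X)) hX
  rw [neg_add_cancel, Matrix.mul_zero, sub_zero] at h
  rw [lyapunovRhs, neg_inj, add_sub_right_comm (_ + _), ← h]
  abel

/-- The limit of the policy iteration solves the Riccati equation. -/
theorem isRiccati_of_tendsto (h : IsObservableSystem T A B C)
    {Qs : ℕ → ℝ → Matrix (Fin n) (Fin n) ℝ} (hc : ∀ i, Continuous (Qs i))
    (hlyap : ∀ i, IsLyapunov (fun t => A t + B t * -((B t)ᵀ * Qs i t))
        (fun t => (C t)ᵀ * C t + (-((B t)ᵀ * Qs i t))ᵀ * -((B t)ᵀ * Qs i t)) (Qs (i + 1)))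
    {c : ℝ} (hb : ∀ i t a b, |Qs i t a b| ≤ c) (hs : ∀ t, (Q t)ᵀ = Q t)
    (hlim : ∀ t, Tendsto (fun i => Qs i t) atTop (𝓝 (Q t))) : IsRiccati A B C Q := by
  set f : ℕ → ℝ → Matrix (Fin n) (Fin n) ℝ :=
    fun i s => lyapunovRhs (A s, B s, C s, Qs (i + 1) s, Qs i s) with hf
  set g : ℝ → Matrix (Fin n) (Fin n) ℝ :=
    fun s => lyapunovRhs (A s, B s, C s, Q s, Q s) with hg
  have hpc : ∀ X Y : ℝ → Matrix (Fin n) (Fin n) ℝ, Continuous X → Continuous Y →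
      PiecewiseContinuous fun s => lyapunovRhs (A s, B s, C s, X s, Y s) := fun X Y hX hY =>
    (h.pc_A.prodMk (h.pc_B.prodMk (h.pc_C.prodMk (hX.piecewiseContinuous.prodMk
      hY.piecewiseContinuous)))).comp continuous_lyapunovRhs
  have hfpc : ∀ i, PiecewiseContinuous (f i) := fun i => hpc _ _ (hc _) (hc _)
  have hfg : ∀ s a b, Tendsto (fun i => f i s a b) atTop (𝓝 (g s a b)) := fun s a b => by
    have h1 : Tendsto (fun i => (A s, B s, C s, Qs (i + 1) s, Qs i s)) atTop
        (𝓝 (A s, B s, C s, Q s, Q s)) :=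
      tendsto_const_nhds.prodMk_nhds (tendsto_const_nhds.prodMk_nhds
        (tendsto_const_nhds.prodMk_nhds
          (((tendsto_add_atTop_iff_nat 1).mpr (hlim s)).prodMk_nhds (hlim s))))
    exact ((continuous_lyapunovRhs.matrix_elem a b).tendsto _).comp h1
  obtain ⟨a₀, -, hA⟩ := h.pc_A.exists_entry_bound h.period_pos h.periodic_A
  obtain ⟨b₀, -, hB⟩ := h.pc_B.exists_entry_bound h.period_pos h.periodic_B
  obtain ⟨c₀, -, hC⟩ := h.pc_C.exists_entry_bound h.period_pos h.periodic_C
  have hfb : ∀ a b, ∃ M, ∀ i s, |f i s a b| ≤ M := fun a b => by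
    obtain ⟨M, hM⟩ := ((isCompact_entry_bound n n a₀).prod ((isCompact_entry_bound n m b₀).prod
      ((isCompact_entry_bound k n c₀).prod ((isCompact_entry_bound n n c).prod
        (isCompact_entry_bound n n c))))).exists_bound_of_continuousOn
      (continuous_lyapunovRhs.matrix_elem a b).continuousOn
    exact ⟨M, fun i s => hM (A s, B s, C s, Qs (i + 1) s, Qs i s)
      ⟨hA s, hB s, hC s, hb _ s, hb _ s⟩⟩
  choose M hM using hfb
  -- Continuity of the limit is not yet known, so measurability comes from the approximations.
  have hgm : ∀ a b, AEStronglyMeasurable (fun s => g s a b) volume := fun a b =>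
    aestronglyMeasurable_of_tendsto_ae atTop
      (fun i => ((hfpc i).entry a b).aestronglyMeasurable)
      (Eventually.of_forall fun s => hfg s a b)
  have hgb : ∀ a b s, |g s a b| ≤ M a b := fun a b s =>
    le_of_tendsto (hfg s a b).abs (Eventually.of_forall fun i => hM a b i s)
  have hgi : ∀ a b u v, IntervalIntegrable (fun s => g s a b) volume u v := fun a b u v =>
    IntervalIntegrable.mono_fun (f := fun _ => M a b) intervalIntegrable_const
      (hgm a b).restrict (Eventually.of_forall fun s => (hgb a b s).trans (le_abs_self _))
  have hint : ∀ i a b t, ∫ s in (0 : ℝ)..t, f i s a b = Qs (i + 1) t a b - Qs (i + 1) 0 a b := by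
    intro i a b t
    obtain ⟨hci, S, hS, hd⟩ := hlyap i
    exact integral_eq_of_hasDerivAt_off_countable (fun s => Qs (i + 1) s a b) _ hS.countable
      (hci.matrix_elem a b).continuousOn (fun s hs => hd s hs.2 a b)
      (((hfpc i).entry a b).intervalIntegrable 0 t)
  have hQe : ∀ a b, (fun t => Q t a b) = fun t => Q 0 a b + ∫ s in (0 : ℝ)..t, g s a b := by
    intro a b
    funext t
    have h1 : Tendsto (fun i => ∫ s in (0 : ℝ)..t, f i s a b) atTop
        (𝓝 (∫ s in (0 : ℝ)..t, g s a b)) :=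
      intervalIntegral.tendsto_integral_filter_of_dominated_convergence (fun _ => M a b)
        (Eventually.of_forall fun i => ((hfpc i).entry a b).aestronglyMeasurable.restrict)
        (Eventually.of_forall fun i => Eventually.of_forall fun s _ => hM a b i s)
        intervalIntegrable_const (Eventually.of_forall fun s _ => hfg s a b)
    have hl : ∀ t, Tendsto (fun i => Qs (i + 1) t a b) atTop (𝓝 (Q t a b)) := fun t =>
      ((continuous_id.matrix_elem a b).tendsto _).comp
        ((tendsto_add_atTop_iff_nat 1).mpr (hlim t))
    simp only [hint] at h1
    have := tendsto_nhds_unique h1 ((hl t).sub (hl 0))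
    linarith
  have hQc : Continuous Q := continuous_matrix fun a b => by
    rw [hQe a b]
    exact continuous_const.add (intervalIntegral.continuous_primitive (hgi a b) 0)
  -- As a primitive of a bounded function `Q` is continuous; only now is `g` piecewise continuous,
  -- and the integral equation can be differentiated off its discontinuities.
  have hgpc : PiecewiseContinuous g := hpc Q Q hQc hQc
  obtain ⟨S, hS, hcont⟩ := hgpc.1
  refine ⟨hQc, S, hS, fun t ht => ?_⟩
  refine HasEntryDerivAt.congr_deriv (X := Q) (X' := g t) (fun a b => ?_)
    (lyapunovRhs_self _ _ _ (hs t))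
  rw [hQe a b]
  exact ((hgpc.entry a b).hasDerivAt_integral 0
    ((continuous_id.matrix_elem a b).continuousAt.comp (hcont t ht))).const_add _

theorem exists_isRiccati (h : IsObservableSystem T A B C) (hK : IsGain T K)
    (hst : ExponentiallyStable fun t => A t + B t * K t) :
    ∃ Q, IsRiccati A B C Q ∧ Function.Periodic Q T ∧ ∀ t, (Q t).PosDef := by
  obtain ⟨Qs, hc, hp, hpsd, hlyap, hanti⟩ := exists_policy_iteration h hK hst
  have hs := fun i t => (posSemidef_iff_real.mp (hpsd i t)).1
  have hnn := fun i t => (posSemidef_iff_real.mp (hpsd i t)).2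
  have hconv : ∀ t v, ∃ l, Tendsto (fun i => v ⬝ᵥ (Qs i t *ᵥ v)) atTop (𝓝 l) := fun t v =>
    ⟨_, tendsto_atTop_ciInf (hanti t v) ⟨0, by rintro _ ⟨i, rfl⟩; exact hnn i t v⟩⟩
  choose l hl using hconv
  let Q : ℝ → Matrix (Fin n) (Fin n) ℝ := fun t => Matrix.of fun a b =>
    (l t (Pi.single a 1 + Pi.single b 1) - l t (Pi.single a 1) - l t (Pi.single b 1)) / 2
  have hlim : ∀ t, Tendsto (fun i => Qs i t) atTop (𝓝 (Q t)) := fun t => by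
    refine tendsto_pi_nhds.mpr fun a => tendsto_pi_nhds.mpr fun b => ?_
    simp only [entry_polarization (hs _ t) a b]
    exact (((hl t _).sub (hl t _)).sub (hl t _)).div_const 2
  have hQs : ∀ t, (Q t).PosSemidef := fun t => by
    refine posSemidef_iff_real.mpr ⟨?_, fun v => ?_⟩
    · refine tendsto_nhds_unique (((continuous_id.matrix_transpose).tendsto _).comp (hlim t)) ?_
      simpa only [Function.comp_def, id, hs] using hlim t
    · have h1 : Continuous fun M : Matrix (Fin n) (Fin n) ℝ => v ⬝ᵥ (M *ᵥ v) :=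
        continuous_const.dotProduct (continuous_id.matrix_mulVec continuous_const)
      exact ge_of_tendsto' ((h1.tendsto _).comp (hlim t)) fun i => hnn i t v
  have hQp : Function.Periodic Q T := fun t => by
    refine tendsto_nhds_unique (hlim (t + T)) ?_
    simpa only [hp _ t] using hlim t
  obtain ⟨r, hr0, hr⟩ := (hc 0).piecewiseContinuous.exists_entry_bound h.period_pos (hp 0)
  have hq : ∀ i t (v : Fin n → ℝ), ‖v‖ ≤ 2 → |v ⬝ᵥ (Qs i t *ᵥ v)| ≤ n * n * r * 4 := by
    intro i t v hv
    rw [abs_of_nonneg (hnn i t v)]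
    refine (hanti t v (Nat.zero_le i)).trans ((le_abs_self _).trans
      ((abs_quadratic_le hr0 (hr t) v).trans ?_))
    have : ‖v‖ ^ 2 ≤ 4 := by nlinarith [norm_nonneg v]
    gcongr
  -- Polarization has three terms, each at most `4 n² r` on vectors of norm at most `2`, and halves
  -- their sum.
  have hb : ∀ i t a b, |Qs i t a b| ≤ 6 * (n * n * r) := fun i t a b => by
    rw [entry_polarization (hs i t) a b]
    have e : ∀ a : Fin n, ‖(Pi.single a 1 : Fin n → ℝ)‖ ≤ 2 := fun a => by
      rw [norm_single_one]; norm_num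
    have h1 := hq i t (Pi.single a 1 + Pi.single b 1) ((norm_add_le _ _).trans (by
      rw [norm_single_one, norm_single_one]; norm_num))
    have h2 := hq i t (Pi.single a 1) (e a)
    have h3 := hq i t (Pi.single b 1) (e b)
    rw [abs_le] at *
    constructor <;> linarith
  have hR := isRiccati_of_tendsto h hc hlyap hb (fun t => (posSemidef_iff_real.mp (hQs t)).1) hlim
  exact ⟨Q, hR, hQp, hR.posDef h hQp hQs⟩

end Riccati

/-! ### Absorbing `α` into the system matrix -/

section Shift

variable {n m k q : ℕ} {T : ℝ} {A : ℝ → Matrix (Fin n) (Fin n) ℝ}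
  {B : ℝ → Matrix (Fin n) (Fin m) ℝ} {Bw : ℝ → Matrix (Fin n) (Fin q) ℝ}
  {C : ℝ → Matrix (Fin k) (Fin n) ℝ} {D : ℝ → Matrix (Fin k) (Fin m) ℝ} {α : ℝ → ℝ}
  {K : ℝ → Matrix (Fin m) (Fin n) ℝ} {P Q : ℝ → Matrix (Fin n) (Fin n) ℝ}

/-- The system matrix shifted by `α / 2`. -/
noncomputable def shifted (A : ℝ → Matrix (Fin n) (Fin n) ℝ) (α : ℝ → ℝ) :
    ℝ → Matrix (Fin n) (Fin n) ℝ :=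
  fun t => A t + (α t / 2) • (1 : Matrix (Fin n) (Fin n) ℝ)

theorem IsPlant.isObservableSystem (h : IsPlant T A B Bw C D) (hα : IsParameter T α) :
    IsObservableSystem T (shifted A α) B C where
  period_pos := h.period_pos
  pc_A := h.pc_A.add ((hα.pc.comp (g := fun r : ℝ => r / 2) (by fun_prop)).smul_matrix
    continuous_const.piecewiseContinuous)
  pc_B := h.pc_B
  pc_C := h.pc_C
  periodic_A := fun t => by simp only [shifted, h.periodic_A t, hα.periodic t]
  periodic_B := h.periodic_B
  periodic_C := h.periodic_C
  observable := h.observable.add_smul_one (hα.pc.comp (g := fun r : ℝ => r / 2) (by fun_prop))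

theorem isAdmissibleGain_iff : IsAdmissibleGain T A B α K ↔
    IsGain T K ∧ ExponentiallyStable fun t => shifted A α t + B t * K t := by
  simp only [IsAdmissibleGain, shifted, add_right_comm]

theorem isRiccatiSolution_iff : IsRiccatiSolution T A B C α Q ↔
    Function.Periodic Q T ∧ (∀ t, (Q t).PosDef) ∧ IsRiccati (shifted A α) B C Q := by
  have e : (fun (t : ℝ) (X : Matrix (Fin n) (Fin n) ℝ) => -(X * A t + (A t)ᵀ * X + α t • X
      + (C t)ᵀ * C t - X * B t * (B t)ᵀ * X)) = fun t X => -(X * shifted A α t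
      + (shifted A α t)ᵀ * X + (C t)ᵀ * C t - X * B t * (B t)ᵀ * X) := by
    funext t X
    have h : α t • X = (α t / 2) • X + (α t / 2) • X := by rw [← add_smul, add_halves]
    rw [h, shifted, Matrix.transpose_add, Matrix.transpose_smul, Matrix.transpose_one,
      Matrix.mul_add, Matrix.add_mul, Matrix.mul_smul, Matrix.smul_mul, Matrix.mul_one,
      Matrix.one_mul]
    abel
  rw [IsRiccatiSolution, e]

/-- The intensity `(1 / α) B_w B_wᵀ` of the disturbance. -/
noncomputable def noise (Bw : ℝ → Matrix (Fin n) (Fin q) ℝ) (α : ℝ → ℝ) :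
    ℝ → Matrix (Fin n) (Fin n) ℝ :=
  fun t => (1 / α t) • (Bw t * (Bw t)ᵀ)

/-- `P` solves the forward Lyapunov equation `P' = F P + P Fᵀ + W`. -/
abbrev IsForwardLyapunov (F W P : ℝ → Matrix (Fin n) (Fin n) ℝ) : Prop :=
  IsMatrixSolution (fun t X => F t * X + X * (F t)ᵀ + W t) P

theorem isEllipsoidMatrix_iff : IsEllipsoidMatrix T A B Bw α K P ↔
    Function.Periodic P T ∧ (∀ t, (P t).PosSemidef) ∧
      IsForwardLyapunov (fun t => shifted A α t + B t * K t) (noise Bw α) P := by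
  have e : (fun (t : ℝ) (X : Matrix (Fin n) (Fin n) ℝ) => (A t + B t * K t) * X
      + X * (A t + B t * K t)ᵀ + α t • X + (1 / α t) • (Bw t * (Bw t)ᵀ)) = fun t X =>
      (shifted A α t + B t * K t) * X + X * (shifted A α t + B t * K t)ᵀ + noise Bw α t := by
    funext t X
    have h : α t • X = (α t / 2) • X + (α t / 2) • X := by rw [← add_smul, add_halves]
    rw [h, shifted, noise, add_right_comm (A t), Matrix.transpose_add _ (_ • _),
      Matrix.transpose_smul, Matrix.transpose_one, Matrix.mul_add, Matrix.add_mul _ (_ • _),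
      Matrix.mul_smul, Matrix.smul_mul, Matrix.mul_one, Matrix.one_mul]
    abel
  rw [IsEllipsoidMatrix, e]

theorem pc_noise (hBw : PiecewiseContinuous Bw) (hα : IsParameter T α) :
    PiecewiseContinuous (noise Bw α) := by
  obtain ⟨c, hc, h⟩ := hα.pos
  -- Truncating at the lower bound `c` makes the reciprocal continuous on the whole line without
  -- changing it on the values of `α`.
  have h1 : PiecewiseContinuous fun t => 1 / max (α t) c :=
    hα.pc.comp (g := fun r => 1 / max r c) (continuous_const.div (by fun_prop) fun r =>
      (lt_of_lt_of_le hc (le_max_right _ _)).ne')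
  simp only [max_eq_left (h _)] at h1
  exact h1.smul_matrix (hBw.matrix_mul hBw.matrix_transpose)

theorem posSemidef_noise (hα : IsParameter T α) (t : ℝ) : (noise Bw α t).PosSemidef := by
  obtain ⟨c, hc, h⟩ := hα.pos
  exact (posSemidef_mul_transpose_self _).smul (one_div_nonneg.mpr (hc.le.trans (h t)))

end Shift

/-! ### Forward Lyapunov equation by time reversal -/

section ForwardLyapunov

variable {n : ℕ} {F W P P' X : ℝ → Matrix (Fin n) (Fin n) ℝ} {T : ℝ}

theorem IsForwardLyapunov.comp_neg (hP : IsForwardLyapunov F W P) :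
    IsLyapunov (fun t => (F (-t))ᵀ) (fun t => W (-t)) fun t => P (-t) := by
  obtain ⟨hc, S, hS, hd⟩ := hP
  refine ⟨hc.comp continuous_neg, _, hS.neg, fun t ht => ?_⟩
  refine (HasEntryDerivAt.comp_neg (X := P) (hd (-t) ht)).congr_deriv ?_
  simp only [Matrix.transpose_transpose]
  abel

theorem IsLyapunov.comp_neg (hX : IsLyapunov (fun t => (F (-t))ᵀ) (fun t => W (-t)) X) :
    IsForwardLyapunov F W fun t => X (-t) := by
  obtain ⟨hc, S, hS, hd⟩ := hX
  refine ⟨hc.comp continuous_neg, _, hS.neg, fun t ht => ?_⟩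
  refine (HasEntryDerivAt.comp_neg (X := X) (hd (-t) ht)).congr_deriv ?_
  simp only [Matrix.transpose_transpose, neg_neg]
  abel

theorem periodic_comp_neg {E : Type*} {f : ℝ → E} (hf : Function.Periodic f T) :
    Function.Periodic (fun t => f (-t)) T := fun t => by
  have h := hf (-(t + T))
  rw [show -(t + T) + T = -t by ring] at h
  exact h.symm

theorem exists_isForwardLyapunov (hT : 0 < T) (hF : PiecewiseContinuous F)
    (hFp : Function.Periodic F T) (hst : ExponentiallyStable F) (hW : PiecewiseContinuous W)
    (hWp : Function.Periodic W T) (hWs : ∀ t, (W t).PosSemidef) :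
    ∃ P, IsForwardLyapunov F W P ∧ Function.Periodic P T ∧ ∀ t, (P t).PosSemidef := by
  obtain ⟨X, hX, hXp, hXs⟩ := exists_isLyapunov hT hF.matrix_transpose.comp_neg
    (periodic_comp_neg (hFp.comp fun M => Mᵀ)) (hst.adjoint hT hF hFp) hW.comp_neg
    (periodic_comp_neg hWp) fun t => hWs (-t)
  exact ⟨_, hX.comp_neg, periodic_comp_neg hXp, fun t => hXs (-t)⟩

theorem IsForwardLyapunov.unique (hP : IsForwardLyapunov F W P) (hP' : IsForwardLyapunov F W P')
    (hT : 0 < T) (hF : PiecewiseContinuous F)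
    (hFp : Function.Periodic F T) (hst : ExponentiallyStable F) (hPp : Function.Periodic P T)
    (hPp' : Function.Periodic P' T) (hs : ∀ t, (P t)ᵀ = P t) (hs' : ∀ t, (P' t)ᵀ = P' t) :
    P = P' := by
  have h := hP.comp_neg.unique hP'.comp_neg hT hF.matrix_transpose.comp_neg
    (periodic_comp_neg (hFp.comp fun M => Mᵀ)) (hst.adjoint hT hF hFp) (periodic_comp_neg hPp)
    (periodic_comp_neg hPp') (fun t => hs (-t)) fun t => hs' (-t)
  funext t
  simpa using congrFun h (-t)

end ForwardLyapunov

/-! ### The size formula -/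

section Size

variable {n m k q : ℕ}

theorem trace_conj_eq_sum (M : Matrix (Fin m) (Fin n) ℝ) (P : Matrix (Fin n) (Fin n) ℝ) :
    (M * P * Mᵀ).trace = ∑ i, M.row i ⬝ᵥ (P *ᵥ M.row i) := by
  simp only [Matrix.trace, Matrix.diag]
  refine Finset.sum_congr rfl fun i _ => ?_
  rw [Matrix.mul_apply, Matrix.dotProduct_mulVec]
  rfl

theorem trace_conj_nonneg (M : Matrix (Fin m) (Fin n) ℝ) {P : Matrix (Fin n) (Fin n) ℝ}
    (hP : P.PosSemidef) : 0 ≤ (M * P * Mᵀ).trace := by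
  rw [trace_conj_eq_sum]
  exact Finset.sum_nonneg fun i _ => (posSemidef_iff_real.mp hP).2 _

theorem eq_zero_of_trace_conj {M : Matrix (Fin m) (Fin n) ℝ} {P : Matrix (Fin n) (Fin n) ℝ}
    (hP : P.PosDef) (h : (M * P * Mᵀ).trace = 0) : M = 0 := by
  rw [trace_conj_eq_sum, Finset.sum_eq_zero_iff_of_nonneg fun i _ =>
    (posSemidef_iff_real.mp hP.posSemidef).2 (M.row i)] at h
  ext i j
  by_contra hij
  have h1 : M.row i ≠ 0 := fun h0 => hij (congrFun h0 j)
  exact ((posDef_iff_real.mp hP).2 _ h1).ne' (h i (Finset.mem_univ i))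

theorem trace_output (C : Matrix (Fin k) (Fin n) ℝ) (D : Matrix (Fin k) (Fin m) ℝ)
    (K : Matrix (Fin m) (Fin n) ℝ) (P : Matrix (Fin n) (Fin n) ℝ) (horth : Dᵀ * C = 0)
    (hunit : Dᵀ * D = 1) :
    ((C + D * K) * P * (C + D * K)ᵀ).trace = ((Cᵀ * C + Kᵀ * K) * P).trace := by
  have h1 : Cᵀ * D = 0 := by
    rw [← Matrix.transpose_transpose D, ← Matrix.transpose_mul, horth, Matrix.transpose_zero]
  have h2 : (C + D * K)ᵀ * (C + D * K) = Cᵀ * C + Kᵀ * K := by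
    have e1 : Cᵀ * (D * K) = 0 := by rw [← Matrix.mul_assoc, h1, Matrix.zero_mul]
    have e2 : Kᵀ * Dᵀ * C = 0 := by rw [Matrix.mul_assoc, horth, Matrix.mul_zero]
    have e3 : Kᵀ * Dᵀ * (D * K) = Kᵀ * K := by
      rw [Matrix.mul_assoc, ← Matrix.mul_assoc Dᵀ, hunit, Matrix.one_mul]
    rw [Matrix.transpose_add, Matrix.transpose_mul, Matrix.mul_add, Matrix.add_mul,
      Matrix.add_mul, e1, e2, e3]
    abel
  rw [Matrix.trace_mul_comm, ← Matrix.mul_assoc, h2]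

theorem ae_eq_zero_of_periodic {f : ℝ → ℝ} (hf : PiecewiseContinuous f) {T : ℝ} (hT : 0 < T)
    (hp : Function.Periodic f T) (h0 : ∀ t, 0 ≤ f t) (hi : ∫ t in (0 : ℝ)..T, f t = 0) :
    ∀ᵐ t : ℝ, f t = 0 := by
  have h : ∀ j : ℤ, ∀ᵐ t : ℝ, t ∈ Set.Ioc ((j : ℝ) * T) (j * T + T) → f t = 0 := fun j => by
    have h1 := hp.intervalIntegral_add_eq ((j : ℝ) * T) 0
    rw [zero_add, hi] at h1
    rw [intervalIntegral.integral_eq_zero_iff_of_le_of_nonneg_ae (by linarith)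
      (Eventually.of_forall h0) (hf.intervalIntegrable _ _)] at h1
    exact (ae_restrict_iff' measurableSet_Ioc).mp h1
  filter_upwards [ae_all_iff.mpr h] with t ht
  -- The period intervals are open on the left, hence the ceiling minus one rather than the floor.
  refine ht (⌈t / T⌉ - 1) ⟨?_, ?_⟩
  · have := Int.ceil_lt_add_one (t / T)
    rw [← lt_div_iff₀ hT]
    push_cast
    linarith
  · have := Int.le_ceil (t / T)
    rw [div_le_iff₀ hT] at this
    push_cast
    linarith

variable {T : ℝ} {A : ℝ → Matrix (Fin n) (Fin n) ℝ} {B : ℝ → Matrix (Fin n) (Fin m) ℝ}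
  {C : ℝ → Matrix (Fin k) (Fin n) ℝ} {D : ℝ → Matrix (Fin k) (Fin m) ℝ}
  {K : ℝ → Matrix (Fin m) (Fin n) ℝ} {P Q W : ℝ → Matrix (Fin n) (Fin n) ℝ}

/-- The forward and backward equations are dual under the trace pairing: by cyclicity all terms
containing `F` cancel. -/
theorem IsLyapunov.hasDerivAt_trace {F V : ℝ → Matrix (Fin n) (Fin n) ℝ}
    (hQ : IsLyapunov F V Q) (hP : IsForwardLyapunov F W P) :
    ∃ S, LocallyFiniteSet S ∧ ∀ t, t ∉ S → HasDerivAt (fun s => (Q s * P s).trace)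
      ((Q t * W t).trace - (V t * P t).trace) t := by
  obtain ⟨-, S, hS, hd⟩ := hQ
  obtain ⟨-, S', hS', hd'⟩ := hP
  refine ⟨S ∪ S', hS.union hS', fun t ht => ?_⟩
  rw [Set.mem_union, not_or] at ht
  refine (HasEntryDerivAt.mul (X := Q) (Y := P) (hd t ht.1) (hd' t ht.2)).trace.congr_deriv ?_
  have h : ((F t)ᵀ * (Q t * P t)).trace = (Q t * (P t * (F t)ᵀ)).trace := by
    rw [Matrix.trace_mul_comm, Matrix.mul_assoc]
  simp only [Matrix.neg_mul, Matrix.add_mul, Matrix.mul_add, Matrix.trace_add, Matrix.trace_neg,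
    Matrix.mul_assoc, h]
  ring

/-- The size of an ellipsoid in terms of the deviation of the gain from `-Bᵀ Q`. -/
theorem IsRiccati.size_eq (h : IsObservableSystem T A B C) (hD : ∀ t, (D t)ᵀ * C t = 0)
    (hD' : ∀ t, (D t)ᵀ * D t = 1) (hQ : IsRiccati A B C Q) (hQp : Function.Periodic Q T)
    (hs : ∀ t, (Q t)ᵀ = Q t) (hK : IsGain T K) (hW : PiecewiseContinuous W)
    (hP : IsForwardLyapunov (fun t => A t + B t * K t) W P) (hPp : Function.Periodic P T) :
    size T C D K P = (1 / T) * ((∫ t in (0 : ℝ)..T,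
      ((K t + (B t)ᵀ * Q t) * P t * (K t + (B t)ᵀ * Q t)ᵀ).trace)
      + ∫ t in (0 : ℝ)..T, (Q t * W t).trace) := by
  have hPc := hP.1.piecewiseContinuous
  have hQc := hQ.1.piecewiseContinuous
  have hΔ : PiecewiseContinuous fun t => K t + (B t)ᵀ * Q t :=
    hK.1.add (h.pc_B.matrix_transpose.matrix_mul hQc)
  have i1 : PiecewiseContinuous fun t => (((C t)ᵀ * C t + (K t)ᵀ * K t) * P t).trace :=
    (((h.pc_C.matrix_transpose.matrix_mul h.pc_C).add
      (hK.1.matrix_transpose.matrix_mul hK.1)).matrix_mul hPc).trace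
  have i2 : PiecewiseContinuous fun t =>
      ((K t + (B t)ᵀ * Q t) * P t * (K t + (B t)ᵀ * Q t)ᵀ).trace :=
    ((hΔ.matrix_mul hPc).matrix_mul hΔ.matrix_transpose).trace
  have i3 : PiecewiseContinuous fun t => (Q t * W t).trace := (hQc.matrix_mul hW).trace
  obtain ⟨S, hS, hd⟩ := (hQ.isLyapunov hs K).hasDerivAt_trace hP
  have hint := integral_eq_of_hasDerivAt_off_countable (a := 0) (b := T)
    (fun s => (Q s * P s).trace)
    (fun t => ((K t + (B t)ᵀ * Q t) * P t * (K t + (B t)ᵀ * Q t)ᵀ).trace + (Q t * W t).trace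
      - (((C t)ᵀ * C t + (K t)ᵀ * K t) * P t).trace) hS.countable
    (hQ.1.matrix_mul hP.1).matrix_trace.continuousOn
    (fun t ht => (hd t ht.2).congr_deriv (by
      rw [Matrix.sub_mul, Matrix.trace_sub, Matrix.trace_mul_comm (_ * P t), Matrix.mul_assoc]
      ring))
    (((i2.add i3).sub i1).intervalIntegrable 0 T)
  -- Periodicity removes the boundary term, leaving an identity between integrals over a period.
  have e0 : (Q T * P T).trace = (Q 0 * P 0).trace := by
    have hq := hQp 0
    have hp := hPp 0
    rw [zero_add] at hq hp
    rw [hq, hp]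
  rw [e0, sub_self, intervalIntegral.integral_sub ((i2.add i3).intervalIntegrable 0 T)
    (i1.intervalIntegrable 0 T), intervalIntegral.integral_add (i2.intervalIntegrable 0 T)
    (i3.intervalIntegrable 0 T), sub_eq_zero] at hint
  rw [size, hint]
  simp only [fun t => trace_output (C t) (D t) (K t) (P t) (hD t) (hD' t)]

end Size

end PeriodicLTV

/-! ### The main theorem -/

theorem theorem4 {n m k q : ℕ} (T : ℝ)
    (A : ℝ → Matrix (Fin n) (Fin n) ℝ) (B : ℝ → Matrix (Fin n) (Fin m) ℝ)
    (Bw : ℝ → Matrix (Fin n) (Fin q) ℝ) (C : ℝ → Matrix (Fin k) (Fin n) ℝ)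
    (D : ℝ → Matrix (Fin k) (Fin m) ℝ)
    (hplant : PeriodicLTV.IsPlant T A B Bw C D)
    (α : ℝ → ℝ) (hα : PeriodicLTV.IsParameter T α) :
    -- the Riccati equation has exactly one positive definite periodic solution as soon as the
    -- closed-loop ellipsoid is well defined for at least one gain
    ((∃ K, PeriodicLTV.IsAdmissibleGain T A B α K) →
      ∃! Q, PeriodicLTV.IsRiccatiSolution T A B C α Q) ∧
    -- the gain `-Bᵀ Q` is admissible and minimizes the size of the ellipsoid
    ∀ Q, PeriodicLTV.IsRiccatiSolution T A B C α Q →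
      PeriodicLTV.IsAdmissibleGain T A B α (fun t => -((B t)ᵀ * Q t)) ∧
      ∃ Popt, PeriodicLTV.IsEllipsoidMatrix T A B Bw α (fun t => -((B t)ᵀ * Q t)) Popt ∧
        (∀ P, PeriodicLTV.IsEllipsoidMatrix T A B Bw α (fun t => -((B t)ᵀ * Q t)) P → P = Popt) ∧
        ∀ K, PeriodicLTV.IsGain T K → ∀ P, PeriodicLTV.IsEllipsoidMatrix T A B Bw α K P →
          PeriodicLTV.size T C D (fun t => -((B t)ᵀ * Q t)) Popt
              ≤ PeriodicLTV.size T C D K P ∧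
          -- a nondegenerate minimizer is unique (up to values on a null set)
          (PeriodicLTV.size T C D K P
              ≤ PeriodicLTV.size T C D (fun t => -((B t)ᵀ * Q t)) Popt →
            (∀ t, (P t).PosDef) → ∀ᵐ t : ℝ, K t = -((B t)ᵀ * Q t)) := by
  open PeriodicLTV in
  have hsys := hplant.isObservableSystem hα
  have hT := hplant.period_pos
  refine ⟨fun ⟨K, hK⟩ => ?_, fun Q hQ => ?_⟩
  · rw [isAdmissibleGain_iff] at hK
    obtain ⟨Q, hQ, hQp, hpd⟩ := exists_isRiccati hsys hK.1 hK.2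
    refine ⟨Q, isRiccatiSolution_iff.mpr ⟨hQp, hpd, hQ⟩, fun Q' hQ' => ?_⟩
    obtain ⟨hQp', hpd', hQ'⟩ := isRiccatiSolution_iff.mp hQ'
    exact hQ'.unique hsys hQ hQp' hQp hpd' hpd
  · obtain ⟨hQp, hpd, hQ⟩ := isRiccatiSolution_iff.mp hQ
    have hs := fun t => (posDef_iff_real.mp (hpd t)).1
    have hg := hsys.isGain hQ.1 hQp
    have hst := hQ.exponentiallyStable hsys hQp hpd
    have hW := pc_noise hplant.pc_Bw hα
    obtain ⟨P₀, hP₀, hPp₀, hPs₀⟩ := exists_isForwardLyapunov hT (hsys.pc_loop hg)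
      (hsys.periodic_loop hg) hst hW
      (fun t => by simp only [noise, hα.periodic t, hplant.periodic_Bw t])
      (posSemidef_noise hα)
    refine ⟨isAdmissibleGain_iff.mpr ⟨hg, hst⟩, P₀, isEllipsoidMatrix_iff.mpr ⟨hPp₀, hPs₀, hP₀⟩,
      fun P hP => ?_, fun K hK P hP => ?_⟩
    · obtain ⟨hPp, hPs, hP⟩ := isEllipsoidMatrix_iff.mp hP
      exact hP.unique hP₀ hT (hsys.pc_loop hg) (hsys.periodic_loop hg) hst hPp hPp₀
        (fun t => (posSemidef_iff_real.mp (hPs t)).1)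
        fun t => (posSemidef_iff_real.mp (hPs₀ t)).1
    · obtain ⟨hPp, hPs, hP⟩ := isEllipsoidMatrix_iff.mp hP
      -- For the optimal gain the deviation is zero, so its size is the gain-independent noise term
      -- alone.
      have hopt := hQ.size_eq hsys hplant.orth hplant.unit hQp hs hg hW hP₀ hPp₀
      simp only [neg_add_cancel, Matrix.zero_mul, Matrix.trace_zero,
        intervalIntegral.integral_zero, zero_add] at hopt
      rw [hQ.size_eq hsys hplant.orth hplant.unit hQp hs hK hW hP hPp, hopt, mul_add,
        le_add_iff_nonneg_left, add_le_iff_nonpos_left]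
      have hnn : ∀ t, 0 ≤ ((K t + (B t)ᵀ * Q t) * P t * (K t + (B t)ᵀ * Q t)ᵀ).trace :=
        fun t => trace_conj_nonneg _ (hPs t)
      have hint := intervalIntegral.integral_nonneg (μ := MeasureTheory.volume) hT.le
        fun t _ => hnn t
      refine ⟨mul_nonneg (by positivity) hint, fun hle hPd => ?_⟩
      have hz : ∫ t in (0 : ℝ)..T,
          ((K t + (B t)ᵀ * Q t) * P t * (K t + (B t)ᵀ * Q t)ᵀ).trace = 0 :=
        le_antisymm (nonpos_of_mul_nonpos_right hle (by positivity)) hint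
      have hΔ : PiecewiseContinuous fun t => K t + (B t)ᵀ * Q t :=
        hK.1.add (hplant.pc_B.matrix_transpose.matrix_mul hQ.1.piecewiseContinuous)
      filter_upwards [ae_eq_zero_of_periodic
        ((hΔ.matrix_mul hP.1.piecewiseContinuous).matrix_mul hΔ.matrix_transpose).trace hT
        (fun t => by simp only [hK.2 t, hplant.periodic_B t, hQp t, hPp t]) hnn hz] with t ht
      exact eq_neg_of_add_eq_zero_left (eq_zero_of_trace_conj (hPd t) ht)
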